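/- Let $p>1$ be a real number, and let $G$, $H$ be countably infinite, connected graphs of bounded degree without loops or multiple edges, with vertex sets $V_G,V_H$, fixed base vertices $o_G,o_H$ and shortest path metrics $d_G,d_H$. Notation, for $G$ (and likewise for $H$). Write $N_x$ for the set of neighbours of $x$. For $f:V_G\to\mathbb R$ let $I_p(f)=\sum_{x\in V_G}\sum_{y\in N_x}|f(y)-f(x)|^p$. Let $D_p(G)=\{f: I_p(f)<\infty\}$ with norm $\|f\|_{D_p}=(I_p(f)+|f(o_G)|^p)^{1/p}$, let $BD_p(G)$ be the algebra of bounded functions in $D_p(G)$, and let $B_0(G)$ be the set of bounded functions in the $D_p(G)$-closure of the finitely supported functions. Let $BHD_p(G)$ be the set of $h\in BD_p(G)$ that are $p$-harmonic, that is, $\sum_{y\in N_x}|h(y)-h(x)|^{p-2}(h(y)-h(x))=0$ for every $x\in V_G$, where terms with $h(y)=h(x)$ are $0$. Let $Sp(BD_p(G))$ be the space of characters (nonzero homomorphisms) $\tau:BD_p(G)\to\mathbb C$ with the weak-$*$ topology, let $\hat f(\tau)=\tau(f)$, and regard $V_G\subset Sp(BD_p(G))$ through point evaluations. The $p$-harmonic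 boundary is $$\partial_p(G)=\{\tau\in Sp(BD_p(G))\setminus V_G:\ \hat f(\tau)=0\text{ for all }f\in B_0(G)\}.$$ A function $g$ is a harmonic projection of $f\in BD_p(G)$ if $g\in BHD_p(G)$ and $f-g\in B_0(G)$. A map $\varphi:V_G\to V_H$ is a rough isometry with constants $a\ge1$, $b\ge0$, $c>0$ if $\frac1a d_G(x,x')-b\le d_H(\varphi(x),\varphi(x'))\le a\,d_G(x,x')+b$ for all $x,x'\in V_G$ and every $y\in V_H$ satisfies $d_H(\varphi(x),y)<c$ for some $x\in V_G$. A rough inverse of $\varphi$ is a rough isometry $\psi:V_H\to V_G$ such that, for some such constants $a,b,c$ of $\varphi$, $d_G(\psi(\varphi(x)),x)\le a(c+b)$ for all $x\in V_G$ and $d_H(\varphi(\psi(y)),y)\le c$ for all $y\in V_H$. Theorem. Let $\varphi:V_G\to V_H$ be a rough isometry. Then there are a homeomorphism $\bar\varphi:\partial_p(G)\to\partial_p(H)$ and a bijection $\Phi:BHD_p(G)\to BHD_p(H)$ such that: 1. $\bar\varphi$ is induced by $\varphi$: for each $x\in\partial_p(G)$ and each net $(x_\alpha)$ in $V_G$ that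 converges to $x$ in $Sp(BD_p(G))$, the net $\varphi(x_\alpha)$ converges to $\bar\varphi(x)$ in $Sp(BD_p(H))$. 2. $\widehat{\Phi(h)}(\bar\varphi(x))=\hat h(x)$ for all $h\in BHD_p(G)$ and $x\in\partial_p(G)$. 3. $\varphi$ has a rough inverse, and for every rough inverse $\psi$ of $\varphi$ and every $h\in BHD_p(G)$ we have $h\circ\psi\in BD_p(H)$ and $\Phi(h)$ is a harmonic projection of $h\circ\psi$; if the constant function $1$ is not in $B_0(H)$ (that is, if $H$ is $p$-hyperbolic), it is the only one. -/

import Mathlib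

open Filter Topology

namespace PHarm

variable {V : Type*}

/-- `|Df(x)|^p`, the sum over the neighbours `y` of `x` of `|f y - f x|^p`. -/
noncomputable def gradPow (G : SimpleGraph V) [G.LocallyFinite] (p : ℝ) (f : V → ℝ) (x : V) : ℝ :=
  ∑ y ∈ G.neighborFinset x, |f y - f x| ^ p

/-- The `p`-Dirichlet sum `I_p(f, V)`; only used for `p`-Dirichlet finite `f`. -/
noncomputable def dirichletSum (G : SimpleGraph V) [G.LocallyFinite] (p : ℝ) (f : V → ℝ) : ℝ :=
  ∑' x, gradPow G p f x

/-- The `p`-Laplacian. A term with `f y = f x` is `0`, whatever the sign of `p - 2`. -/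
noncomputable def pLaplacian (G : SimpleGraph V) [G.LocallyFinite] (p : ℝ) (f : V → ℝ) (x : V) : ℝ :=
  ∑ y ∈ G.neighborFinset x, |f y - f x| ^ (p - 2) * (f y - f x)

/-- `f` is `p`-harmonic on the whole vertex set. -/
def IsPHarmonic (G : SimpleGraph V) [G.LocallyFinite] (p : ℝ) (f : V → ℝ) : Prop :=
  ∀ x, pLaplacian G p f x = 0

/-- `f ∈ D_p(G)`: the sum of nonnegative terms `I_p(f, V)` is finite. -/
def DirichletFinite (G : SimpleGraph V) [G.LocallyFinite] (p : ℝ) (f : V → ℝ) : Prop :=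
  Summable (gradPow G p f)

/-- `f ∈ ℓ^∞`. -/
def IsBdd (f : V → ℝ) : Prop := ∃ M : ℝ, ∀ x, |f x| ≤ M

/-- The norm of `D_p(G)` with base vertex `o`. -/
noncomputable def dpNorm (G : SimpleGraph V) [G.LocallyFinite] (p : ℝ) (o : V) (f : V → ℝ) : ℝ :=
  (dirichletSum G p f + |f o| ^ p) ^ (1 / p)

lemma gradPow_nonneg (G : SimpleGraph V) [G.LocallyFinite] (p : ℝ) (f : V → ℝ) (x : V) :
    0 ≤ gradPow G p f x :=
  Finset.sum_nonneg fun _ _ => Real.rpow_nonneg (abs_nonneg _) _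

/-- If the increments of `k` are bounded by fixed multiples of those of `f` and `g`, and `f`, `g`
are `p`-Dirichlet finite, then so is `k`. -/
lemma dirichletFinite_of_le (G : SimpleGraph V) [G.LocallyFinite] {p : ℝ} (hp : 1 < p)
    {f g k : V → ℝ} (hf : DirichletFinite G p f) (hg : DirichletFinite G p g)
    (A B : ℝ) (hA : 0 ≤ A) (hB : 0 ≤ B)
    (h : ∀ x y, |k y - k x| ≤ A * |f y - f x| + B * |g y - g x|) : DirichletFinite G p k := by
  have hsum : Summable fun x =>
      (2 * A) ^ p * gradPow G p f x + (2 * B) ^ p * gradPow G p g x :=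
    (hf.mul_left _).add (hg.mul_left _)
  refine Summable.of_nonneg_of_le (fun x => gradPow_nonneg G p k x) (fun x => ?_) hsum
  unfold gradPow
  rw [Finset.mul_sum, Finset.mul_sum, ← Finset.sum_add_distrib]
  refine Finset.sum_le_sum fun y _ => ?_
  have hp0 : 0 ≤ p := by linarith
  set s := |f y - f x| with hs
  set t := |g y - g x| with ht
  have hs0 : 0 ≤ s := abs_nonneg _
  have ht0 : 0 ≤ t := abs_nonneg _
  have h1 : 0 ≤ (2 * A) ^ p * s ^ p := by positivity
  have h2 : 0 ≤ (2 * B) ^ p * t ^ p := by positivity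
  rcases le_total (A * s) (B * t) with hle | hle
  · have : |k y - k x| ≤ 2 * B * t := by linarith [h x y]
    calc |k y - k x| ^ p ≤ (2 * B * t) ^ p := Real.rpow_le_rpow (abs_nonneg _) this hp0
      _ = (2 * B) ^ p * t ^ p := Real.mul_rpow (by positivity) ht0
      _ ≤ _ := by linarith
  · have : |k y - k x| ≤ 2 * A * s := by linarith [h x y]
    calc |k y - k x| ^ p ≤ (2 * A * s) ^ p := Real.rpow_le_rpow (abs_nonneg _) this hp0
      _ = (2 * A) ^ p * s ^ p := Real.mul_rpow (by positivity) hs0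
      _ ≤ _ := by linarith

lemma dirichletFinite_const (G : SimpleGraph V) [G.LocallyFinite] {p : ℝ} (hp : 1 < p) (c : ℝ) :
    DirichletFinite G p (fun _ => c) := by
  have : gradPow G p (fun _ : V => c) = fun _ => 0 := by
    funext x
    have hp0 : p ≠ 0 := by linarith
    simp [gradPow, Real.zero_rpow hp0]
  unfold DirichletFinite
  rw [this]
  exact summable_zero

/-- The algebra `BD_p(G)` of bounded `p`-Dirichlet finite functions, with pointwise operations. -/
def BD (G : SimpleGraph V) [G.LocallyFinite] (p : ℝ) (hp : 1 < p) : Subalgebra ℝ (V → ℝ) where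
  carrier := {f | DirichletFinite G p f ∧ IsBdd f}
  algebraMap_mem' c := ⟨dirichletFinite_const G hp c, |c|, fun _ => le_rfl⟩
  add_mem' := by
    rintro f g ⟨hf, M, hM⟩ ⟨hg, N, hN⟩
    refine ⟨dirichletFinite_of_le G hp hf hg 1 1 zero_le_one zero_le_one fun x y => ?_,
      M + N, fun x => (abs_add_le _ _).trans (add_le_add (hM x) (hN x))⟩
    have : (f + g) y - (f + g) x = (f y - f x) + (g y - g x) := by
      simp only [Pi.add_apply]; ring
    rw [this, one_mul, one_mul]
    exact abs_add_le _ _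
  mul_mem' := by
    rintro f g ⟨hf, M, hM⟩ ⟨hg, N, hN⟩
    refine ⟨dirichletFinite_of_le G hp hf hg |N| |M| (abs_nonneg _) (abs_nonneg _)
      fun x y => ?_, |M| * |N|, fun x => ?_⟩
    · have : (f * g) y - (f * g) x = g y * (f y - f x) + f x * (g y - g x) := by
        simp only [Pi.mul_apply]; ring
      rw [this]
      refine (abs_add_le _ _).trans ?_
      rw [abs_mul, abs_mul]
      exact add_le_add
        (mul_le_mul_of_nonneg_right ((hN y).trans (le_abs_self _)) (abs_nonneg _))
        (mul_le_mul_of_nonneg_right ((hM x).trans (le_abs_self _)) (abs_nonneg _))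
    · rw [Pi.mul_apply, abs_mul]
      exact mul_le_mul ((hM x).trans (le_abs_self _)) ((hN x).trans (le_abs_self _))
        (abs_nonneg _) (abs_nonneg _)

/-- `BHD_p(G)`: the bounded `p`-Dirichlet finite functions that are `p`-harmonic on `V`. -/
def BHD (G : SimpleGraph V) [G.LocallyFinite] (p : ℝ) (hp : 1 < p) : Set (V → ℝ) :=
  {h | IsPHarmonic G p h ∧ h ∈ BD G p hp}

/-- An element of `BHD_p(G)`, regarded as an element of `BD_p(G)`. -/
def BHD.toBD {G : SimpleGraph V} [G.LocallyFinite] {p : ℝ} {hp : 1 < p} (h : BHD G p hp) :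
    BD G p hp := ⟨h.1, h.2.2⟩

/-- The bounded functions in the `D_p(G)`-closure of the finitely supported functions. -/
def BD0 (G : SimpleGraph V) [G.LocallyFinite] (p : ℝ) (hp : 1 < p) (o : V) : Set (V → ℝ) :=
  {f | f ∈ BD G p hp ∧ ∀ ε : ℝ, 0 < ε →
    ∃ u : V → ℝ, (Function.support u).Finite ∧ dpNorm G p o (f - u) < ε}

/-- The spectrum `Sp(BD_p(G))`. A nonzero multiplicative linear map from a unital algebra to a
field sends `1` to `1`, so the characters are exactly the unital algebra homomorphisms to `ℂ`. -/
def Sp (G : SimpleGraph V) [G.LocallyFinite] (p : ℝ) (hp : 1 < p) : Type _ :=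
  BD G p hp →ₐ[ℝ] ℂ

/-- The Gelfand transform `f̂(τ) = τ(f)`. -/
noncomputable def gelfand {G : SimpleGraph V} [G.LocallyFinite] {p : ℝ} {hp : 1 < p} (f : BD G p hp)
    (τ : Sp G p hp) : ℂ :=
  (show BD G p hp →ₐ[ℝ] ℂ from τ) f

/-- The weak-* topology, that is, the topology of pointwise convergence on `BD_p(G)`. -/
noncomputable instance (G : SimpleGraph V) [G.LocallyFinite] (p : ℝ) (hp : 1 < p) :
    TopologicalSpace (Sp G p hp) :=
  TopologicalSpace.induced (fun τ (f : BD G p hp) => gelfand f τ) inferInstance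

/-- The map `i : V → Sp(BD_p(G))`, evaluation at a vertex. -/
noncomputable def vertexChar (G : SimpleGraph V) [G.LocallyFinite] (p : ℝ) (hp : 1 < p) (x : V) :
    Sp G p hp :=
  (Complex.ofRealAm.comp (Pi.evalAlgHom ℝ (fun _ : V => ℝ) x)).comp (BD G p hp).val

/-- The `p`-Royden boundary `Sp(BD_p(G)) \ V`. -/
def roydenBoundary (G : SimpleGraph V) [G.LocallyFinite] (p : ℝ) (hp : 1 < p) : Set (Sp G p hp) :=
  (Set.range (vertexChar G p hp))ᶜ

/-- The `p`-harmonic boundary `∂_p(G)`, with the subspace topology when used as a type. -/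
def harmonicBoundary (G : SimpleGraph V) [G.LocallyFinite] (p : ℝ) (hp : 1 < p) (o : V) :
    Set (Sp G p hp) :=
  {τ | τ ∈ roydenBoundary G p hp ∧
    ∀ f : BD G p hp, (f : V → ℝ) ∈ BD0 G p hp o → gelfand f τ = 0}

/-- `h` is a harmonic projection of `f`: `f = u + h` with `u` a bounded function in the closure of
the finitely supported functions and `h ∈ BHD_p(G)`. -/
def IsHarmonicProjection (G : SimpleGraph V) [G.LocallyFinite] (p : ℝ) (hp : 1 < p) (o : V)
    (f h : V → ℝ) : Prop :=
  f ∈ BD G p hp ∧ h ∈ BHD G p hp ∧ f - h ∈ BD0 G p hp o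

variable {W : Type*}

/-- `φ` is a rough isometry with constants `a`, `b`, `c` for the shortest path metrics. -/
def IsRoughIsometryWith (G : SimpleGraph V) (H : SimpleGraph W) (a b c : ℝ) (φ : V → W) : Prop :=
  1 ≤ a ∧ 0 ≤ b ∧ 0 < c ∧
  (∀ x y, (1 / a) * (G.dist x y : ℝ) - b ≤ (H.dist (φ x) (φ y) : ℝ) ∧
    (H.dist (φ x) (φ y) : ℝ) ≤ a * (G.dist x y : ℝ) + b) ∧
  ∀ y, ∃ x, (H.dist (φ x) y : ℝ) < c

def IsRoughIsometry (G : SimpleGraph V) (H : SimpleGraph W) (φ : V → W) : Prop :=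
  ∃ a b c : ℝ, IsRoughIsometryWith G H a b c φ

/-- `ψ` is a rough inverse of the rough isometry `φ`. -/
def IsRoughInverse (G : SimpleGraph V) (H : SimpleGraph W) (φ : V → W) (ψ : W → V) : Prop :=
  IsRoughIsometry H G ψ ∧ ∃ a b c : ℝ, IsRoughIsometryWith G H a b c φ ∧
    (∀ x, (G.dist (ψ (φ x)) x : ℝ) ≤ a * (c + b)) ∧ ∀ y, (H.dist (φ (ψ y)) y : ℝ) ≤ c

end PHarm

open PHarm

/-! Everything is determined modulo `BD0`. A rough isometry of graphs of bounded degree has fibres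
of bounded size and moves neighbours to points at bounded distance, so composition with it
multiplies the energy by at most a constant and keeps supports finite. Hence `f ↦ f ∘ φ` carries `BD
H` into `BD G` and `BD0 H` into `BD0 G` (`IsTame.comp_mem_BD`, `IsTame.comp_mem_BD0`), and likewise
for a rough inverse `ψ`. Moving points a bounded distance changes a function of `BD` by a bounded
`p`-summable function, which lies in `BD0` (`comp_sub_comp_mem_BD0`, `mem_BD0_of_tsum_ne_top`). So
composition with `φ` and composition with `ψ` are inverse to each other modulo `BD0`.

The characters in the harmonic boundary are exactly those that kill `BD0`. Precomposition with these
algebra maps therefore gives mutually inverse continuous maps of the boundaries. On all of the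
spectrum the map is continuous and extends `φ`, which yields the statement about nets.

For the harmonic functions, each class modulo `BD0` contains an element of `BHD`, found by
minimizing the energy (`exists_isHarmonicProjection`). Uniform convexity shows that two such
elements differ by a constant (`BHD.energy_sub_eq_zero`). If `1 ∉ BD0`, the constant is zero and
`BHD` represents the classes, so the bijection is inherited from them. If `1 ∈ BD0`, then `BD0` is
all of `BD` (`mem_BD0_of_one_mem`), `BHD` consists of the constants and the boundary is empty. -/

open scoped ENNReal

namespace PHarm

/-! ### Energy with values in `[0, ∞]`: convexity, semicontinuity, pointwise control. -/

section

variable {V : Type*} {G : SimpleGraph V} [G.LocallyFinite] {p : ℝ}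

/-- The `p`-Dirichlet sum with values in `[0, ∞]`. -/
noncomputable def energy (G : SimpleGraph V) [G.LocallyFinite] (p : ℝ) (f : V → ℝ) : ℝ≥0∞ :=
  ∑' x, ENNReal.ofReal (gradPow G p f x)

lemma dirichletFinite_iff_energy_ne_top {f : V → ℝ} :
    DirichletFinite G p f ↔ energy G p f ≠ ⊤ := by
  refine ⟨fun h => h.tsum_ofReal_ne_top, fun h => ?_⟩
  have := ENNReal.summable_toReal h
  simpa only [DirichletFinite, ENNReal.toReal_ofReal (gradPow_nonneg G p f _)] using this

lemma toReal_energy (f : V → ℝ) : (energy G p f).toReal = dirichletSum G p f := by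
  unfold energy dirichletSum
  rw [ENNReal.tsum_toReal_eq fun _ => ENNReal.ofReal_ne_top]
  exact tsum_congr fun x => ENNReal.toReal_ofReal (gradPow_nonneg G p f x)

lemma energy_eq_ofReal {f : V → ℝ} (hf : DirichletFinite G p f) :
    energy G p f = ENNReal.ofReal (dirichletSum G p f) := by
  rw [← toReal_energy, ENNReal.ofReal_toReal (dirichletFinite_iff_energy_ne_top.1 hf)]

lemma dirichletSum_nonneg (f : V → ℝ) : 0 ≤ dirichletSum G p f :=
  tsum_nonneg fun x => gradPow_nonneg G p f x

lemma gradPow_le_gradPow (hp : 0 ≤ p) {f g : V → ℝ} {x : V}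
    (h : ∀ y, G.Adj x y → |f y - f x| ≤ |g y - g x|) : gradPow G p f x ≤ gradPow G p g x :=
  Finset.sum_le_sum fun y hy =>
    Real.rpow_le_rpow (abs_nonneg _) (h y ((G.mem_neighborFinset x y).1 hy)) hp

lemma energy_le_energy (hp : 0 ≤ p) {f g : V → ℝ}
    (h : ∀ x y, G.Adj x y → |f y - f x| ≤ |g y - g x|) : energy G p f ≤ energy G p g :=
  ENNReal.tsum_le_tsum fun x => ENNReal.ofReal_le_ofReal (gradPow_le_gradPow hp (h x))

lemma energy_congr (hp : 0 ≤ p) {f g : V → ℝ}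
    (h : ∀ x y, G.Adj x y → |f y - f x| = |g y - g x|) : energy G p f = energy G p g :=
  le_antisymm (energy_le_energy hp fun x y hxy => (h x y hxy).le)
    (energy_le_energy hp fun x y hxy => (h x y hxy).ge)

lemma energy_neg (hp : 0 ≤ p) (f : V → ℝ) : energy G p (-f) = energy G p f :=
  energy_congr hp fun x y _ => by
    simp only [Pi.neg_apply]; rw [← abs_neg]; congr 1; ring

lemma energy_sub_comm (hp : 0 ≤ p) (f g : V → ℝ) : energy G p (f - g) = energy G p (g - f) := by
  rw [← energy_neg hp, neg_sub]

/-- Convexity of `t ↦ t ^ p`, in the form of a weighted triangle inequality. -/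
lemma add_rpow_le_weighted (hp : 1 ≤ p) {a b r : ℝ} (ha : 0 ≤ a) (hb : 0 ≤ b) (hr0 : 0 < r)
    (hr1 : r < 1) : (a + b) ^ p ≤ r ^ (1 - p) * a ^ p + (1 - r) ^ (1 - p) * b ^ p := by
  have hs : 0 < 1 - r := by linarith
  have h := (convexOn_rpow hp).2 (x := a / r) (y := b / (1 - r)) (by simp; positivity)
    (by simp; positivity) hr0.le hs.le (by ring)
  simp only [smul_eq_mul] at h
  rw [mul_div_cancel₀ _ hr0.ne', mul_div_cancel₀ _ hs.ne', Real.div_rpow ha hr0.le,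
    Real.div_rpow hb hs.le] at h
  rw [Real.rpow_sub hr0, Real.rpow_sub hs, Real.rpow_one, Real.rpow_one]
  calc _ ≤ _ := h
    _ = _ := by ring

lemma gradPow_le_weighted (hp : 1 ≤ p) {f g k : V → ℝ} {r : ℝ} (hr0 : 0 < r) (hr1 : r < 1)
    {x : V} (h : ∀ y, G.Adj x y → |k y - k x| ≤ |f y - f x| + |g y - g x|) :
    gradPow G p k x ≤ r ^ (1 - p) * gradPow G p f x + (1 - r) ^ (1 - p) * gradPow G p g x := by
  unfold gradPow
  rw [Finset.mul_sum, Finset.mul_sum, ← Finset.sum_add_distrib]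
  refine Finset.sum_le_sum fun y hy => ?_
  exact (Real.rpow_le_rpow (abs_nonneg _) (h y ((G.mem_neighborFinset x y).1 hy))
    (by linarith)).trans (add_rpow_le_weighted hp (abs_nonneg _) (abs_nonneg _) hr0 hr1)

lemma energy_le_weighted (hp : 1 ≤ p) {f g k : V → ℝ} {r : ℝ} (hr0 : 0 < r) (hr1 : r < 1)
    (h : ∀ x y, G.Adj x y → |k y - k x| ≤ |f y - f x| + |g y - g x|) :
    energy G p k ≤ ENNReal.ofReal (r ^ (1 - p)) * energy G p f +
      ENNReal.ofReal ((1 - r) ^ (1 - p)) * energy G p g := by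
  have hs : 0 < 1 - r := by linarith
  unfold energy
  rw [← ENNReal.tsum_mul_left, ← ENNReal.tsum_mul_left, ← ENNReal.tsum_add]
  refine ENNReal.tsum_le_tsum fun x => ?_
  rw [← ENNReal.ofReal_mul (by positivity), ← ENNReal.ofReal_mul (by positivity),
    ← ENNReal.ofReal_add (mul_nonneg (by positivity) (gradPow_nonneg ..))
      (mul_nonneg (by positivity) (gradPow_nonneg ..))]
  exact ENNReal.ofReal_le_ofReal (gradPow_le_weighted hp hr0 hr1 (h x))

lemma tendsto_energy_add (hp : 1 ≤ p) {ι : Type*} {l : Filter ι} {f g : ι → V → ℝ}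
    (hf : Tendsto (fun i => energy G p (f i)) l (𝓝 0))
    (hg : Tendsto (fun i => energy G p (g i)) l (𝓝 0)) :
    Tendsto (fun i => energy G p (f i + g i)) l (𝓝 0) := by
  have h1 := (ENNReal.Tendsto.const_mul (a := ENNReal.ofReal ((1 / 2 : ℝ) ^ (1 - p))) hf
    (Or.inr ENNReal.ofReal_ne_top)).add (ENNReal.Tendsto.const_mul
      (a := ENNReal.ofReal ((1 - 1 / 2 : ℝ) ^ (1 - p))) hg (Or.inr ENNReal.ofReal_ne_top))
  simp only [mul_zero, add_zero] at h1
  refine tendsto_of_tendsto_of_tendsto_of_le_of_le tendsto_const_nhds h1 (fun _ => zero_le)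
    fun i => energy_le_weighted hp (by norm_num) (by norm_num) fun x y _ => ?_
  have : (f i + g i) y - (f i + g i) x = (f i y - f i x) + (g i y - g i x) := by
    simp only [Pi.add_apply]; ring
  rw [this]
  exact abs_add_le _ _

/-- Lower bounds for the energy persist under convergence in energy. -/
lemma le_energy_of_tendsto (hp : 1 ≤ p) {ι : Type*} {l : Filter ι} [l.NeBot] {f : ι → V → ℝ}
    {g : V → ℝ} {m : ℝ≥0∞} (hm : ∀ i, m ≤ energy G p (f i))
    (hf : Tendsto (fun i => energy G p (f i - g)) l (𝓝 0)) : m ≤ energy G p g := by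
  -- For fixed `r` the coefficient of the error `f i - g` is a constant, so the error disappears in
  -- the limit over `i`; only then does `r → 1` bring the coefficient of `energy G p g` down to `1`.
  have key : ∀ r : ℝ, 0 < r → r < 1 → m ≤ ENNReal.ofReal (r ^ (1 - p)) * energy G p g := by
    intro r hr0 hr1
    have h1 := (ENNReal.Tendsto.const_mul (a := ENNReal.ofReal ((1 - r) ^ (1 - p))) hf
      (Or.inr ENNReal.ofReal_ne_top)).const_add (ENNReal.ofReal (r ^ (1 - p)) * energy G p g)
    simp only [mul_zero, add_zero] at h1
    refine ge_of_tendsto h1 (Eventually.of_forall fun i => (hm i).trans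
      (energy_le_weighted hp hr0 hr1 fun x y _ => ?_))
    have : f i y - f i x = (g y - g x) + ((f i - g) y - (f i - g) x) := by
      simp only [Pi.sub_apply]; ring
    rw [this]
    exact abs_add_le _ _
  by_cases hg : energy G p g = ⊤
  · simp [hg]
  have hlim : Tendsto (fun r : ℝ => ENNReal.ofReal (r ^ (1 - p)) * energy G p g) (𝓝[<] 1)
      (𝓝 (ENNReal.ofReal ((1 : ℝ) ^ (1 - p)) * energy G p g)) := by
    refine ENNReal.Tendsto.mul_const ?_ (Or.inr hg)
    refine (ENNReal.continuous_ofReal.tendsto _).comp ?_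
    exact ((Real.continuousAt_rpow_const _ _ (Or.inl one_ne_zero)).tendsto).mono_left
      nhdsWithin_le_nhds
  rw [Real.one_rpow, ENNReal.ofReal_one, one_mul] at hlim
  refine ge_of_tendsto hlim ?_
  filter_upwards [Ioo_mem_nhdsLT (zero_lt_one' ℝ)] with r hr using key r hr.1 hr.2

/-- Fatou's lemma for the energy. -/
lemma energy_le_of_tendsto (hp : 0 ≤ p) {ι : Type*} {l : Filter ι} [l.NeBot] {f : ι → V → ℝ}
    {g : V → ℝ} {c : ℝ≥0∞} (hfg : ∀ x, Tendsto (fun i => f i x) l (𝓝 (g x)))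
    (hc : ∀ᶠ i in l, energy G p (f i) ≤ c) : energy G p g ≤ c := by
  unfold energy
  rw [ENNReal.tsum_eq_iSup_sum]
  refine iSup_le fun s => ?_
  have hlim : Tendsto (fun i => ∑ x ∈ s, ENNReal.ofReal (gradPow G p (f i) x)) l
      (𝓝 (∑ x ∈ s, ENNReal.ofReal (gradPow G p g x))) := by
    refine tendsto_finsetSum _ fun x _ => (ENNReal.continuous_ofReal.tendsto _).comp ?_
    refine tendsto_finsetSum _ fun y _ => ?_
    exact (((hfg y).sub (hfg x)).abs).rpow_const (Or.inr hp)
  refine le_of_tendsto hlim ?_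
  filter_upwards [hc] with i hi using (ENNReal.sum_le_tsum s).trans hi

lemma ofReal_rpow_le_energy (f : V → ℝ) {x y : V} (h : G.Adj x y) :
    ENNReal.ofReal (|f y - f x| ^ p) ≤ energy G p f := by
  refine le_trans (ENNReal.ofReal_le_ofReal ?_) (ENNReal.le_tsum x)
  exact Finset.single_le_sum (f := fun y => |f y - f x| ^ p)
    (fun _ _ => Real.rpow_nonneg (abs_nonneg _) _) ((G.mem_neighborFinset x y).2 h)

/-- A function on a connected graph with vanishing energy is constant. -/
lemma eq_of_energy_eq_zero (hG : G.Connected) (hp : 0 < p) {f : V → ℝ}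
    (hf : energy G p f = 0) (x y : V) : f x = f y := by
  obtain ⟨w⟩ := hG.preconnected x y
  induction w with
  | nil => rfl
  | @cons x z y hadj _ ih =>
    have h1 := ofReal_rpow_le_energy (p := p) f hadj
    rw [hf, nonpos_iff_eq_zero, ENNReal.ofReal_eq_zero] at h1
    have h2 : |f z - f x| ^ p = 0 := le_antisymm h1 (Real.rpow_nonneg (abs_nonneg _) _)
    rw [Real.rpow_eq_zero (abs_nonneg _) hp.ne', abs_eq_zero, sub_eq_zero] at h2
    rw [← h2, ih]

/-- Convergence to zero in energy and at one vertex implies convergence at every vertex. -/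
lemma tendsto_apply_of_tendsto_energy (hG : G.Connected) (hp : 0 < p) {ι : Type*}
    {l : Filter ι} {f : ι → V → ℝ} (hf : Tendsto (fun i => energy G p (f i)) l (𝓝 0)) (o : V)
    (ho : Tendsto (fun i => f i o) l (𝓝 0)) (x : V) : Tendsto (fun i => f i x) l (𝓝 0) := by
  obtain ⟨w⟩ := hG.preconnected x o
  induction w with
  | nil => exact ho
  | @cons x z y hadj _ ih =>
    have h1 : Tendsto (fun i => ENNReal.ofReal (|f i z - f i x| ^ p)) l (𝓝 0) :=
      tendsto_of_tendsto_of_tendsto_of_le_of_le tendsto_const_nhds hf (fun _ => zero_le)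
        fun i => ofReal_rpow_le_energy (f i) hadj
    have h2 : Tendsto (fun i => |f i z - f i x| ^ p) l (𝓝 0) := by
      have := (ENNReal.tendsto_toReal ENNReal.zero_ne_top).comp h1
      simpa [Function.comp_def, ENNReal.toReal_ofReal, Real.rpow_nonneg] using this
    have h3 : Tendsto (fun i => |f i z - f i x|) l (𝓝 0) := by
      have := h2.rpow_const (p := p⁻¹) (Or.inr (by positivity))
      rw [Real.zero_rpow (by positivity)] at this
      refine this.congr fun i => ?_
      rw [← Real.rpow_mul (abs_nonneg _), mul_inv_cancel₀ hp.ne', Real.rpow_one]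
    have h4 := (ih ho).sub ((tendsto_zero_iff_abs_tendsto_zero _).2 h3)
    simpa using h4

/-! ### Finitely supported functions and the space `BD0`. -/

lemma gradPow_eq_zero_of_notMem_support (hp : 0 < p) {u : V → ℝ} {x : V}
    (hx : x ∉ Function.support u) (h : ∀ y, G.Adj x y → y ∉ Function.support u) :
    gradPow G p u x = 0 := by
  refine Finset.sum_eq_zero fun y hy => ?_
  have h1 := Function.notMem_support.1 (h y ((G.mem_neighborFinset x y).1 hy))
  rw [h1, Function.notMem_support.1 hx, sub_zero, abs_zero, Real.zero_rpow hp.ne']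

lemma dirichletFinite_of_finite_support (hp : 0 < p) {u : V → ℝ}
    (hu : (Function.support u).Finite) : DirichletFinite G p u := by
  refine summable_of_hasFiniteSupport
    ((hu.union (hu.biUnion fun y _ => (G.neighborFinset y).finite_toSet)).subset ?_)
  intro x hx
  by_contra hcon
  simp only [Set.mem_union, Set.mem_iUnion, not_or, not_exists, Finset.mem_coe,
    G.mem_neighborFinset] at hcon
  exact hx (gradPow_eq_zero_of_notMem_support hp hcon.1 fun y hxy hy => hcon.2 y hy hxy.symm)

lemma mem_BD_of_finite_support (hp : 1 < p) {u : V → ℝ} (hu : (Function.support u).Finite) :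
    u ∈ BD G p hp := by
  refine ⟨dirichletFinite_of_finite_support (by linarith) hu, ?_⟩
  obtain ⟨M, hM⟩ := (hu.image fun x => |u x|).bddAbove
  refine ⟨max M 0, fun x => ?_⟩
  by_cases hx : u x = 0
  · simp [hx]
  · exact le_max_of_le_left (hM ⟨x, hx, rfl⟩)

/-- Pointwise convergence is needed only at the base vertex, since the norm sees nothing else
besides the energy. The filter is arbitrary so that approximations indexed by finite sets of
vertices are covered too. -/
lemma mem_BD0_of_tendsto (hp : 1 < p) {o : V} {f : V → ℝ} (hf : f ∈ BD G p hp) {ι : Type*}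
    {l : Filter ι} [l.NeBot] {u : ι → V → ℝ} (hu : ∀ i, (Function.support (u i)).Finite)
    (hlim : Tendsto (fun i => energy G p (f - u i)) l (𝓝 0))
    (ho : Tendsto (fun i => u i o) l (𝓝 (f o))) : f ∈ BD0 G p hp o := by
  refine ⟨hf, fun ε hε => ?_⟩
  have hp0 : 0 < p := by linarith
  have h1 : Tendsto (fun i => dirichletSum G p (f - u i)) l (𝓝 0) := by
    simpa [Function.comp_def, toReal_energy] using
      (ENNReal.tendsto_toReal ENNReal.zero_ne_top).comp hlim
  have h2 : Tendsto (fun i => |(f - u i) o| ^ p) l (𝓝 0) := by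
    have := ((tendsto_const_nhds (x := f o)).sub ho).abs.rpow_const (p := p) (Or.inr hp0.le)
    simpa [Real.zero_rpow hp0.ne'] using this
  have h3 : Tendsto (fun i => dpNorm G p o (f - u i)) l (𝓝 0) := by
    have := (h1.add h2).rpow_const (p := 1 / p) (Or.inr (by positivity))
    rw [add_zero, Real.zero_rpow (by positivity)] at this
    exact this
  obtain ⟨i, hi⟩ := (h3.eventually (gt_mem_nhds hε)).exists
  exact ⟨u i, hu i, hi⟩

/-- Connectedness spreads convergence from the base vertex to every vertex. This removes the
dependence on the base vertex, so that `BD0` can be compared across maps that do not respect base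
vertices. -/
lemma exists_seq_of_mem_BD0 (hG : G.Connected) (hp : 1 < p) {o : V} {f : V → ℝ}
    (hf : f ∈ BD0 G p hp o) :
    ∃ u : ℕ → V → ℝ, (∀ n, (Function.support (u n)).Finite) ∧
      Tendsto (fun n => energy G p (f - u n)) atTop (𝓝 0) ∧
      ∀ x, Tendsto (fun n => u n x) atTop (𝓝 (f x)) := by
  have hp0 : 0 < p := by linarith
  choose u hu hlt using fun n : ℕ => hf.2 (1 / ((n : ℝ) + 1)) (by positivity)
  have hnn : ∀ n, 0 ≤ dpNorm G p o (f - u n) := fun n =>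
    Real.rpow_nonneg (add_nonneg (dirichletSum_nonneg _) (Real.rpow_nonneg (abs_nonneg _) _)) _
  have h1 : Tendsto (fun n => dpNorm G p o (f - u n)) atTop (𝓝 0) :=
    squeeze_zero hnn (fun n => (hlt n).le) tendsto_one_div_add_atTop_nhds_zero_nat
  have h2 : Tendsto (fun n => dirichletSum G p (f - u n) + |(f - u n) o| ^ p) atTop (𝓝 0) := by
    have := h1.rpow_const (p := p) (Or.inr hp0.le)
    rw [Real.zero_rpow hp0.ne'] at this
    refine this.congr fun n => ?_
    rw [dpNorm, ← Real.rpow_mul (add_nonneg (dirichletSum_nonneg _)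
      (Real.rpow_nonneg (abs_nonneg _) _)), one_div_mul_cancel hp0.ne', Real.rpow_one]
  have h3 : Tendsto (fun n => dirichletSum G p (f - u n)) atTop (𝓝 0) :=
    squeeze_zero (fun n => dirichletSum_nonneg _)
      (fun n => le_add_of_nonneg_right (Real.rpow_nonneg (abs_nonneg _) _)) h2
  have h4 : Tendsto (fun n => |(f - u n) o| ^ p) atTop (𝓝 0) :=
    squeeze_zero (fun n => Real.rpow_nonneg (abs_nonneg _) _)
      (fun n => le_add_of_nonneg_left (dirichletSum_nonneg _)) h2
  have h5 : Tendsto (fun n => |(f - u n) o|) atTop (𝓝 0) := by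
    have := h4.rpow_const (p := p⁻¹) (Or.inr (by positivity))
    rw [Real.zero_rpow (by positivity)] at this
    refine this.congr fun i => ?_
    rw [← Real.rpow_mul (abs_nonneg _), mul_inv_cancel₀ hp0.ne', Real.rpow_one]
  have h6 : Tendsto (fun n => energy G p (f - u n)) atTop (𝓝 0) := by
    have := (ENNReal.continuous_ofReal.tendsto _).comp h3
    rw [ENNReal.ofReal_zero] at this
    refine this.congr fun n => (energy_eq_ofReal ?_).symm
    exact ((BD G p hp).sub_mem hf.1 (mem_BD_of_finite_support hp (hu n))).1
  refine ⟨u, hu, h6, fun x => ?_⟩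
  have h7 := tendsto_apply_of_tendsto_energy hG hp0 h6 o
    ((tendsto_zero_iff_abs_tendsto_zero _).2 h5) x
  have h8 := (tendsto_const_nhds (x := f x)).sub h7
  simpa using h8

lemma add_mem_BD0 (hG : G.Connected) (hp : 1 < p) {o : V} {f g : V → ℝ}
    (hf : f ∈ BD0 G p hp o) (hg : g ∈ BD0 G p hp o) : f + g ∈ BD0 G p hp o := by
  obtain ⟨u, hu, hue, hux⟩ := exists_seq_of_mem_BD0 hG hp hf
  obtain ⟨v, hv, hve, hvx⟩ := exists_seq_of_mem_BD0 hG hp hg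
  refine mem_BD0_of_tendsto hp ((BD G p hp).add_mem hf.1 hg.1) (l := atTop)
    (u := fun n => u n + v n) (fun n => ((hu n).union (hv n)).subset
      (Function.support_add _ _)) ?_ ((hux o).add (hvx o))
  refine (tendsto_energy_add hp.le hue hve).congr fun n => ?_
  rw [add_sub_add_comm]

lemma neg_mem_BD0 (hp : 1 < p) {o : V} {f : V → ℝ} (hf : f ∈ BD0 G p hp o) :
    -f ∈ BD0 G p hp o := by
  refine ⟨(BD G p hp).neg_mem hf.1, fun ε hε => ?_⟩
  obtain ⟨u, hu, hlt⟩ := hf.2 ε hε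
  refine ⟨-u, by rwa [Function.support_neg], ?_⟩
  have : -f - -u = -(f - u) := by ring
  rwa [this, dpNorm, ← toReal_energy, energy_neg (by linarith), toReal_energy, Pi.neg_apply,
    abs_neg]

lemma sub_mem_BD0 (hG : G.Connected) (hp : 1 < p) {o : V} {f g : V → ℝ}
    (hf : f ∈ BD0 G p hp o) (hg : g ∈ BD0 G p hp o) : f - g ∈ BD0 G p hp o := by
  rw [sub_eq_add_neg]; exact add_mem_BD0 hG hp hf (neg_mem_BD0 hp hg)

lemma mem_BD0_of_finite_support (hp : 1 < p) {o : V} {u : V → ℝ}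
    (hu : (Function.support u).Finite) : u ∈ BD0 G p hp o := by
  refine ⟨mem_BD_of_finite_support hp hu, fun ε hε => ⟨u, hu, ?_⟩⟩
  have hp0 : p ≠ 0 := by linarith
  simpa [dpNorm, dirichletSum, gradPow, hp0] using hε

lemma const_smul_mem_BD0 (hG : G.Connected) (hp : 1 < p) {o : V} {f : V → ℝ} (c : ℝ)
    (hf : f ∈ BD0 G p hp o) : c • f ∈ BD0 G p hp o := by
  obtain ⟨u, hu, hue, hux⟩ := exists_seq_of_mem_BD0 hG hp hf
  have hp0 : 0 < p := by linarith
  refine mem_BD0_of_tendsto hp ((BD G p hp).smul_mem hf.1 c) (l := atTop)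
    (u := fun n => c • u n) (fun n => (hu n).subset (Function.support_const_smul_subset _ _))
    ?_ ((hux o).const_mul c)
  have h := ENNReal.Tendsto.const_mul (a := ENNReal.ofReal (|c| ^ p)) hue
    (Or.inr ENNReal.ofReal_ne_top)
  rw [mul_zero] at h
  refine h.congr fun n => ?_
  unfold energy
  rw [← ENNReal.tsum_mul_left]
  refine tsum_congr fun x => ?_
  rw [← ENNReal.ofReal_mul (by positivity)]
  congr 1
  unfold gradPow
  rw [Finset.mul_sum]
  refine Finset.sum_congr rfl fun y _ => ?_
  rw [← Real.mul_rpow (abs_nonneg _) (abs_nonneg _), ← abs_mul]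
  congr 2
  simp only [Pi.sub_apply, Pi.smul_apply, smul_eq_mul]; ring

end

/-! ### Scalar inequalities for `|s| ^ p`. -/

section

/-- The derivative of `|s| ^ p / p`. -/
noncomputable def pFlux (p s : ℝ) : ℝ := |s| ^ (p - 2) * s

lemma pFlux_neg (p s : ℝ) : pFlux p (-s) = -pFlux p s := by simp [pFlux]

lemma pFlux_mul_self {p : ℝ} (hp : 0 < p) (s : ℝ) : pFlux p s * s = |s| ^ p := by
  rcases eq_or_ne s 0 with rfl | hs
  · simp [pFlux, Real.zero_rpow hp.ne']
  · have h : 0 < |s| := abs_pos.2 hs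
    rw [pFlux, mul_assoc, ← abs_mul_abs_self s, ← pow_two, ← Real.rpow_natCast |s| 2,
      ← Real.rpow_add h]
    norm_num

lemma abs_pFlux {p : ℝ} (hp : 1 < p) (s : ℝ) : |pFlux p s| = |s| ^ (p - 1) := by
  rcases eq_or_ne s 0 with rfl | hs
  · simp [pFlux, Real.zero_rpow (by linarith : p - 1 ≠ 0)]
  · have h : 0 < |s| := abs_pos.2 hs
    rw [pFlux, abs_mul, abs_of_nonneg (Real.rpow_nonneg h.le _)]
    nth_rewrite 2 [← Real.rpow_one |s|]
    rw [← Real.rpow_add h]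
    congr 1; ring

/-- For `p < 2` the factor `|s| ^ (p - 2)` blows up at `0`; splitting `s` into positive and negative
parts leaves only powers with the positive exponent `p - 1`. -/
lemma continuous_pFlux {p : ℝ} (hp : 1 < p) : Continuous (pFlux p) := by
  have h : pFlux p = fun s => max s 0 ^ (p - 1) - max (-s) 0 ^ (p - 1) := by
    have key : ∀ s : ℝ, 0 ≤ s → pFlux p s = s ^ (p - 1) := fun s hs => by
      have h1 := abs_pFlux hp s
      rwa [abs_of_nonneg hs, abs_of_nonneg (by unfold pFlux; positivity)] at h1
    have h0 : (0 : ℝ) ^ (p - 1) = 0 := Real.zero_rpow (by linarith)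
    funext s
    rcases le_total 0 s with hs | hs
    · rw [max_eq_left hs, max_eq_right (by linarith), h0, sub_zero, key s hs]
    · rw [max_eq_right hs, max_eq_left (by linarith), h0, zero_sub, ← key (-s) (by linarith),
        pFlux_neg, neg_neg]
  rw [h]
  exact ((continuous_id.max continuous_const).rpow_const fun _ => Or.inr (by linarith)).sub
    ((continuous_neg.max continuous_const).rpow_const fun _ => Or.inr (by linarith))

/-- The first order convexity inequality for `|s| ^ p`. -/
lemma abs_add_rpow_ge {p : ℝ} (hp : 1 < p) (s t : ℝ) :
    |s| ^ p + p * (pFlux p s * t) ≤ |s + t| ^ p := by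
  have hp0 : 0 < p := by linarith
  -- Young's inequality for `|s + t|` and `|s| ^ (p - 1)` with exponents `p` and `p / (p - 1)`,
  -- where the second factor contributes `|s| ^ p`.
  have hy := Real.young_inequality_of_nonneg (abs_nonneg (s + t))
    (Real.rpow_nonneg (abs_nonneg s) (p - 1)) (Real.HolderConjugate.conjExponent hp)
  rw [← Real.rpow_mul (abs_nonneg s), Real.conjExponent,
    mul_div_cancel₀ _ (by linarith : p - 1 ≠ 0)] at hy
  have h1 : pFlux p s * (s + t) ≤ |s + t| * |s| ^ (p - 1) := by
    rw [← abs_pFlux hp, mul_comm |s + t|, ← abs_mul]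
    exact le_abs_self _
  have h2 : pFlux p s * t = pFlux p s * (s + t) - |s| ^ p := by
    rw [← pFlux_mul_self hp0]; ring
  have h3 : p * (|s + t| ^ p / p + |s| ^ p / (p / (p - 1))) =
      |s + t| ^ p + (p - 1) * |s| ^ p := by
    field_simp
  have h4 := mul_le_mul_of_nonneg_left (h1.trans hy) hp0.le
  rw [h3] at h4
  rw [h2, mul_sub]
  linarith

/-- The first order inequality at the midpoint, for the two opposite steps to `s` and to `t`: the
linear terms cancel. -/
lemma abs_midpoint_rpow_le {p : ℝ} (hp : 1 < p) (s t : ℝ) :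
    |(s + t) / 2| ^ p ≤ (|s| ^ p + |t| ^ p) / 2 := by
  have h1 := abs_add_rpow_ge hp ((s + t) / 2) ((s - t) / 2)
  have h2 := abs_add_rpow_ge hp ((s + t) / 2) (-((s - t) / 2))
  rw [show (s + t) / 2 + (s - t) / 2 = s by ring] at h1
  rw [show (s + t) / 2 + -((s - t) / 2) = t by ring, mul_neg] at h2
  linarith

/-- If `|s| ≠ |t|`, strict convexity on the half line applies to the absolute values. The remaining
case is `s = -t ≠ 0`, where the midpoint is `0`. -/
lemma abs_midpoint_rpow_lt {p : ℝ} (hp : 1 < p) {s t : ℝ} (hst : s ≠ t) :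
    |(s + t) / 2| ^ p < (|s| ^ p + |t| ^ p) / 2 := by
  rcases eq_or_ne |s| |t| with h | h
  · rcases abs_eq_abs.1 h with h' | h'
    · exact absurd h' hst
    · have ht : t ≠ 0 := fun h0 => hst (by rw [h', h0, neg_zero])
      have : 0 < |t| ^ p := Real.rpow_pos_of_pos (abs_pos.2 ht) p
      rw [h, h', neg_add_cancel, zero_div, abs_zero, Real.zero_rpow (by linarith)]
      linarith
  · have h1 := (strictConvexOn_rpow hp).2 (Set.mem_Ici.2 (abs_nonneg s))
      (Set.mem_Ici.2 (abs_nonneg t)) h (by norm_num : (0 : ℝ) < 1 / 2)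
      (by norm_num : (0 : ℝ) < 1 / 2) (by norm_num)
    simp only [smul_eq_mul] at h1
    have h2 : |(s + t) / 2| ≤ 1 / 2 * |s| + 1 / 2 * |t| := by
      rw [abs_div, abs_two]
      linarith [abs_add_le s t]
    have h3 := Real.rpow_le_rpow (abs_nonneg _) h2 (by linarith : 0 ≤ p)
    linarith

/-- Uniform convexity of `|s| ^ p`, in scale invariant form. -/
lemma exists_abs_sub_rpow_le {p : ℝ} (hp : 1 < p) {ε : ℝ} (hε : 0 < ε) :
    ∃ C : ℝ, 0 ≤ C ∧ ∀ s t : ℝ, |s - t| ^ p ≤ ε * (|s| ^ p + |t| ^ p) +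
      C * ((|s| ^ p + |t| ^ p) / 2 - |(s + t) / 2| ^ p) := by
  have hp0 : 0 < p := by linarith
  have cont : ∀ f : ℝ × ℝ → ℝ, Continuous f → Continuous fun x => |f x| ^ p := fun f hf =>
    hf.abs.rpow_const fun _ => Or.inr hp0.le
  have c1 := cont _ continuous_fst
  have c2 := cont _ continuous_snd
  have c3 := cont _ (continuous_fst.sub continuous_snd)
  have c4 := cont _ ((continuous_fst.add continuous_snd).div_const 2)
  -- By homogeneity it suffices to treat pairs with `|s| ^ p + |t| ^ p = 1`. Off `K` the term `ε`
  -- alone is enough; on the compact set `K` the convexity gap has a positive minimum, so a large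
  -- multiple of it dominates `|s - t| ^ p`.
  let K : Set (ℝ × ℝ) := {x | |x.1| ^ p + |x.2| ^ p = 1 ∧ ε ≤ |x.1 - x.2| ^ p}
  have hKclosed : IsClosed K :=
    (isClosed_eq (c1.add c2) continuous_const).inter (isClosed_le continuous_const c3)
  have hle1 : ∀ a b : ℝ, |a| ^ p + |b| ^ p = 1 → |a| ≤ 1 := fun a b hab => by
    by_contra! hlt
    have := Real.one_lt_rpow hlt hp0
    linarith [Real.rpow_nonneg (abs_nonneg b) p]
  have hKcompact : IsCompact K := by
    refine (isCompact_Icc (a := ((-1, -1) : ℝ × ℝ)) (b := (1, 1))).of_isClosed_subset hKclosed ?_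
    rintro ⟨a, b⟩ ⟨hab, -⟩
    have ha := abs_le.1 (hle1 a b hab)
    have hb := abs_le.1 (hle1 b a (by rw [add_comm]; exact hab))
    exact ⟨⟨ha.1, hb.1⟩, ⟨ha.2, hb.2⟩⟩
  let gap : ℝ × ℝ → ℝ := fun x => (|x.1| ^ p + |x.2| ^ p) / 2 - |(x.1 + x.2) / 2| ^ p
  have hgap : Continuous gap := ((c1.add c2).div_const 2).sub c4
  have hgap0 : ∀ x, 0 ≤ gap x := fun x => sub_nonneg.2 (abs_midpoint_rpow_le hp x.1 x.2)
  obtain ⟨C, hC0, hC⟩ : ∃ C : ℝ, 0 ≤ C ∧ ∀ x : ℝ × ℝ, |x.1| ^ p + |x.2| ^ p = 1 →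
      |x.1 - x.2| ^ p ≤ ε + C * gap x := by
    rcases K.eq_empty_or_nonempty with hK | hK
    · refine ⟨0, le_rfl, fun x hx => ?_⟩
      by_contra! hcon
      have : x ∈ K := ⟨hx, by linarith⟩
      rw [hK] at this
      exact this
    · obtain ⟨x₀, hx₀, hmin⟩ := hKcompact.exists_isMinOn hK hgap.continuousOn
      obtain ⟨B, hB⟩ := (hKcompact.image c3).bddAbove
      have hne : x₀.1 ≠ x₀.2 := fun h => by
        have := hx₀.2
        rw [h, sub_self, abs_zero, Real.zero_rpow hp0.ne'] at this
        linarith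
      have hpos : 0 < gap x₀ := sub_pos.2 (abs_midpoint_rpow_lt hp hne)
      refine ⟨|B| / gap x₀, by positivity, fun x hx => ?_⟩
      rcases lt_or_ge (|x.1 - x.2| ^ p) ε with h | h
      · have := mul_nonneg (div_nonneg (abs_nonneg B) hpos.le) (hgap0 x)
        linarith
      · have hxK : x ∈ K := ⟨hx, h⟩
        have h1 : |x.1 - x.2| ^ p ≤ |B| := (hB ⟨x, hxK, rfl⟩).trans (le_abs_self B)
        have h2 : |B| ≤ |B| / gap x₀ * gap x := by
          rw [div_mul_eq_mul_div, le_div_iff₀ hpos]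
          exact mul_le_mul_of_nonneg_left (hmin hxK) (abs_nonneg B)
        linarith
  refine ⟨C, hC0, fun s t => ?_⟩
  set r := |s| ^ p + |t| ^ p with hr
  have hs0 : 0 ≤ |s| ^ p := Real.rpow_nonneg (abs_nonneg _) _
  have ht0 : 0 ≤ |t| ^ p := Real.rpow_nonneg (abs_nonneg _) _
  rcases (add_nonneg hs0 ht0).eq_or_lt with h0 | hpos
  · have hs : s = 0 := by
      have : |s| ^ p = 0 := by linarith
      rwa [Real.rpow_eq_zero (abs_nonneg _) hp0.ne', abs_eq_zero] at this
    have ht : t = 0 := by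
      have : |t| ^ p = 0 := by linarith
      rwa [Real.rpow_eq_zero (abs_nonneg _) hp0.ne', abs_eq_zero] at this
    simp [hr, hs, ht, Real.zero_rpow hp0.ne']
  · rw [← hr] at hpos
    have hq : 0 < r ^ (1 / p) := Real.rpow_pos_of_pos hpos _
    have hqp : (r ^ (1 / p)) ^ p = r := by
      rw [← Real.rpow_mul hpos.le, one_div_mul_cancel hp0.ne', Real.rpow_one]
    have hdiv : ∀ a : ℝ, |a / r ^ (1 / p)| ^ p = |a| ^ p / r := fun a => by
      rw [abs_div, abs_of_pos hq, Real.div_rpow (abs_nonneg a) hq.le, hqp]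
    have h1 := hC (s / r ^ (1 / p), t / r ^ (1 / p)) (by
      simp only [hdiv]; rw [← add_div, ← hr, div_self hpos.ne'])
    simp only [gap] at h1
    rw [← sub_div, ← add_div, div_right_comm, hdiv, hdiv, hdiv, hdiv, ← add_div, ← hr] at h1
    have h2 := mul_le_mul_of_nonneg_right h1 hpos.le
    rw [div_mul_cancel₀ _ hpos.ne'] at h2
    calc _ ≤ _ := h2
      _ = _ := by field_simp

end

/-! ### Variational characterization of `p`-harmonic functions. -/

section

variable {V : Type*} {G : SimpleGraph V} [G.LocallyFinite] {p : ℝ}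

/-- Summation by parts against a finitely supported function. -/
lemma hasSum_pFlux_mul (f : V → ℝ) {u : V → ℝ} (hu : (Function.support u).Finite) :
    HasSum (fun x => ∑ y ∈ G.neighborFinset x, pFlux p (f y - f x) * (u y - u x))
      (-2 * ∑ x ∈ hu.toFinset, u x * pLaplacian G p f x) := by
  classical
  have hout : ∀ x ∉ hu.toFinset, u x = 0 := fun x hx => by simpa using hx
  have h1 : HasSum (fun x => u x * pLaplacian G p f x)
      (∑ x ∈ hu.toFinset, u x * pLaplacian G p f x) :=
    hasSum_sum_of_ne_finset_zero fun x hx => by rw [hout x hx, zero_mul]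
  -- The part of the sum carrying `u y` is regrouped by the endpoint `z = y`. Oddness of the flux
  -- makes it equal to minus the part carrying `u x`, which explains the factor `-2`.
  have h2 : ∀ z, HasSum (fun x => if G.Adj x z then pFlux p (f z - f x) * u z else 0)
      (-(u z * pLaplacian G p f z)) := by
    intro z
    have h := hasSum_sum_of_ne_finset_zero (L := .unconditional V) (s := G.neighborFinset z)
      (f := fun x => if G.Adj x z then pFlux p (f z - f x) * u z else 0)
      (fun x hx => if_neg fun hxz => hx ((G.mem_neighborFinset z x).2 hxz.symm))
    convert h using 1
    rw [pLaplacian, Finset.mul_sum, ← Finset.sum_neg_distrib]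
    refine Finset.sum_congr rfl fun x hx => ?_
    rw [if_pos ((G.mem_neighborFinset z x).1 hx).symm, ← neg_sub (f x) (f z), pFlux_neg, pFlux]
    ring
  have h3 := (hasSum_sum (s := hu.toFinset) fun z _ => h2 z).sub h1
  have hval : ∑ z ∈ hu.toFinset, -(u z * pLaplacian G p f z) -
      ∑ x ∈ hu.toFinset, u x * pLaplacian G p f x =
      -2 * ∑ x ∈ hu.toFinset, u x * pLaplacian G p f x := by
    rw [Finset.sum_neg_distrib]; ring
  rw [hval] at h3
  refine h3.congr_fun ?_
  intro x
  have h4 : ∑ z ∈ hu.toFinset, (if G.Adj x z then pFlux p (f z - f x) * u z else 0) =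
      ∑ y ∈ G.neighborFinset x, pFlux p (f y - f x) * u y := by
    rw [← Finset.sum_filter]
    refine Finset.sum_subset_zero_on_sdiff (fun z hz => ?_) (fun z hz => ?_) fun _ _ => rfl
    · exact (G.mem_neighborFinset x z).2 (Finset.mem_filter.1 hz).2
    · obtain ⟨hz1, hz2⟩ := Finset.mem_sdiff.1 hz
      rw [hout z fun h => hz2 (Finset.mem_filter.2 ⟨h, (G.mem_neighborFinset x z).1 hz1⟩),
        mul_zero]
  rw [h4, pLaplacian, Finset.mul_sum, ← Finset.sum_sub_distrib]
  refine Finset.sum_congr rfl fun y _ => ?_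
  rw [pFlux]; ring

/-- The first order convexity inequality for the `p`-Dirichlet sum. -/
lemma dirichletSum_add_ge (hp : 1 < p) {f u : V → ℝ} (hf : DirichletFinite G p f)
    (hu : (Function.support u).Finite) :
    dirichletSum G p f + p * (-2 * ∑ x ∈ hu.toFinset, u x * pLaplacian G p f x) ≤
      dirichletSum G p (f + u) := by
  have hfu : DirichletFinite G p (f + u) :=
    dirichletFinite_of_le G hp hf (dirichletFinite_of_finite_support (by linarith) hu) 1 1
      zero_le_one zero_le_one fun x y => by
        have : (f + u) y - (f + u) x = (f y - f x) + (u y - u x) := by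
          simp only [Pi.add_apply]; ring
        rw [this, one_mul, one_mul]
        exact abs_add_le _ _
  refine hasSum_le (fun x => ?_) (hf.hasSum.add ((hasSum_pFlux_mul f hu).mul_left p)) hfu.hasSum
  unfold gradPow
  rw [Finset.mul_sum, ← Finset.sum_add_distrib]
  refine Finset.sum_le_sum fun y _ => (abs_add_rpow_ge hp _ _).trans_eq ?_
  congr 2
  simp only [Pi.add_apply]; ring

/-- A `p`-harmonic function minimizes the energy under finitely supported perturbations. -/
lemma IsPHarmonic.energy_le_energy_add (hp : 1 < p) {f u : V → ℝ} (hh : IsPHarmonic G p f)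
    (hf : DirichletFinite G p f) (hu : (Function.support u).Finite) :
    energy G p f ≤ energy G p (f + u) := by
  by_cases hfin : energy G p (f + u) = ⊤
  · rw [hfin]; exact le_top
  rw [energy_eq_ofReal hf, energy_eq_ofReal (dirichletFinite_iff_energy_ne_top.2 hfin)]
  refine ENNReal.ofReal_le_ofReal ?_
  have h := dirichletSum_add_ge hp hf hu
  rwa [Finset.sum_eq_zero fun x _ => by rw [hh x, mul_zero], mul_zero, mul_zero, add_zero] at h

/-- A minimizer of the energy under finitely supported perturbations is `p`-harmonic. -/
lemma isPHarmonic_of_forall_energy_le (hp : 1 < p) {f : V → ℝ} (hf : f ∈ BD G p hp)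
    (hmin : ∀ u : V → ℝ, (Function.support u).Finite → energy G p f ≤ energy G p (f + u)) :
    IsPHarmonic G p f := by
  classical
  intro z
  -- `L t` is the `p`-Laplacian at `z` of `f` with its value at `z` raised by `t`. The first order
  -- inequality at this perturbed function, with the step `-t` back to `f`, together with minimality
  -- of `f`, gives `t * L t ≤ 0`. Continuity of `L` then forces `L 0 = 0`, without differentiating
  -- the energy.
  let L : ℝ → ℝ := fun t => ∑ y ∈ G.neighborFinset z, pFlux p (f y - (f z + t))
  have hLc : Continuous L := continuous_finsetSum _ fun y _ => (continuous_pFlux hp).comp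
    (continuous_const.sub (continuous_const.add continuous_id))
  have hL0 : L 0 = pLaplacian G p f z := by simp [L, pLaplacian, pFlux]
  have hfin : ∀ t : ℝ, (Function.support (Pi.single z t : V → ℝ)).Finite := fun t =>
    (Set.finite_singleton z).subset Pi.support_single_subset
  have hsign : ∀ t : ℝ, t * L t ≤ 0 := by
    intro t
    have hg : f + Pi.single z t ∈ BD G p hp :=
      (BD G p hp).add_mem hf (mem_BD_of_finite_support hp (hfin t))
    have h1 := dirichletSum_add_ge hp hg.1 (hfin (-t))
    have h2 : f + Pi.single z t + Pi.single z (-t) = f := by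
      rw [add_assoc, ← Pi.single_add, add_neg_cancel, Pi.single_zero, add_zero]
    have h3 : pLaplacian G p (f + Pi.single z t) z = L t := by
      refine Finset.sum_congr rfl fun y hy => ?_
      have hne : y ≠ z := ((G.mem_neighborFinset z y).1 hy).ne'
      simp [pFlux, hne]
    have h4 : ∑ x ∈ (hfin (-t)).toFinset,
        (Pi.single z (-t) : V → ℝ) x * pLaplacian G p (f + Pi.single z t) x = -t * L t := by
      rw [Finset.sum_eq_single z]
      · rw [Pi.single_eq_same, h3]
      · intro x _ hx
        rw [Pi.single_eq_of_ne hx, zero_mul]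
      · intro hz
        have : (Pi.single z (-t) : V → ℝ) z = 0 := by simpa using hz
        rw [this, zero_mul]
    rw [h2, h4] at h1
    have h5 := ENNReal.toReal_mono (dirichletFinite_iff_energy_ne_top.1 hg.1) (hmin _ (hfin t))
    rw [toReal_energy, toReal_energy] at h5
    have h6 : 0 < p := by linarith
    nlinarith
  rw [← hL0]
  refine le_antisymm ?_ ?_
  · refine le_of_tendsto ((hLc.tendsto 0).mono_left (nhdsWithin_le_nhds (s := Set.Ioi 0))) ?_
    filter_upwards [self_mem_nhdsWithin] with t ht
    exact nonpos_of_mul_nonpos_right (hsign t) ht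
  · refine ge_of_tendsto ((hLc.tendsto 0).mono_left (nhdsWithin_le_nhds (s := Set.Iio 0))) ?_
    filter_upwards [self_mem_nhdsWithin] with t ht
    exact nonneg_of_mul_nonpos_right (hsign t) ht

/-- Uniform convexity of the `p`-Dirichlet sum, in terms of midpoints. -/
lemma exists_dirichletSum_sub_le (hp : 1 < p) {ε : ℝ} (hε : 0 < ε) :
    ∃ C : ℝ, 0 ≤ C ∧ ∀ f ∈ BD G p hp, ∀ g ∈ BD G p hp,
      dirichletSum G p (f - g) ≤ ε * (dirichletSum G p f + dirichletSum G p g) +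
        C * ((dirichletSum G p f + dirichletSum G p g) / 2 -
          dirichletSum G p ((1 / 2 : ℝ) • (f + g))) := by
  obtain ⟨C, hC0, hC⟩ := exists_abs_sub_rpow_le hp hε
  refine ⟨C, hC0, fun f hf g hg => ?_⟩
  have hm := (BD G p hp).smul_mem ((BD G p hp).add_mem hf hg) (1 / 2 : ℝ)
  have hs := (BD G p hp).sub_mem hf hg
  have hsum := hf.1.hasSum.add hg.1.hasSum
  refine hasSum_le (fun x => ?_) hs.1.hasSum
    ((hsum.mul_left ε).add (((hsum.div_const 2).sub hm.1.hasSum).mul_left C))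
  unfold gradPow
  rw [← Finset.sum_add_distrib, Finset.mul_sum, Finset.sum_div, ← Finset.sum_sub_distrib,
    Finset.mul_sum, ← Finset.sum_add_distrib]
  refine Finset.sum_le_sum fun y _ => ?_
  have h := hC (f y - f x) (g y - g x)
  have e1 : (f - g) y - (f - g) x = (f y - f x) - (g y - g x) := by
    simp only [Pi.sub_apply]; ring
  have e2 : ((1 / 2 : ℝ) • (f + g)) y - ((1 / 2 : ℝ) • (f + g)) x =
      ((f y - f x) + (g y - g x)) / 2 := by
    simp only [Pi.smul_apply, Pi.add_apply, smul_eq_mul]; ring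
  rw [e1, e2]
  exact h

/-- A `p`-harmonic function minimizes the energy under perturbations from `BD0`. -/
lemma dirichletSum_le_add_of_mem_BD0 (hG : G.Connected) (hp : 1 < p) {o : V} {h u : V → ℝ}
    (hh : h ∈ BHD G p hp) (hu : u ∈ BD0 G p hp o) :
    dirichletSum G p h ≤ dirichletSum G p (h + u) := by
  obtain ⟨v, hv, hve, -⟩ := exists_seq_of_mem_BD0 hG hp hu
  have hle : energy G p h ≤ energy G p (h + u) := by
    refine le_energy_of_tendsto hp.le (l := atTop) (f := fun n => h + v n)
      (fun n => hh.1.energy_le_energy_add hp hh.2.1 (hv n)) (hve.congr fun n => ?_)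
    rw [energy_sub_comm (by linarith), add_sub_add_left_eq_sub]
  rw [← toReal_energy, ← toReal_energy]
  exact ENNReal.toReal_mono
    (dirichletFinite_iff_energy_ne_top.1 ((BD G p hp).add_mem hh.2 hu.1).1) hle

/-- Functions in `BHD` that agree modulo `BD0` differ by a constant. -/
lemma BHD.energy_sub_eq_zero (hG : G.Connected) (hp : 1 < p) {o : V} {h k : V → ℝ}
    (hh : h ∈ BHD G p hp) (hk : k ∈ BHD G p hp) (hhk : h - k ∈ BD0 G p hp o) :
    energy G p (h - k) = 0 := by
  have hkh : k - h ∈ BD0 G p hp o := by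
    have := neg_mem_BD0 hp hhk
    rwa [neg_sub] at this
  have h1 := dirichletSum_le_add_of_mem_BD0 hG hp hh hkh
  rw [add_sub_cancel] at h1
  have h2 := dirichletSum_le_add_of_mem_BD0 hG hp hk hhk
  rw [add_sub_cancel] at h2
  -- The first two inequalities make the energies of `h` and `k` equal. This one bounds the energy
  -- of their midpoint from below by the same value, so there is no convexity gap.
  have h3 := dirichletSum_le_add_of_mem_BD0 hG hp hh (const_smul_mem_BD0 hG hp (1 / 2 : ℝ) hkh)
  have e3 : h + (1 / 2 : ℝ) • (k - h) = (1 / 2 : ℝ) • (h + k) := by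
    funext x; simp only [Pi.add_apply, Pi.smul_apply, Pi.sub_apply, smul_eq_mul]; ring
  rw [e3] at h3
  have h4 : dirichletSum G p (h - k) ≤ 0 := by
    have key : ∀ ε : ℝ, 0 < ε → dirichletSum G p (h - k) ≤
        ε * (dirichletSum G p h + dirichletSum G p k) := by
      intro ε hε
      obtain ⟨C, hC0, hC⟩ := exists_dirichletSum_sub_le (G := G) hp hε
      have h5 := hC h hh.2 k hk.2
      have h6 : C * ((dirichletSum G p h + dirichletSum G p k) / 2 -
          dirichletSum G p ((1 / 2 : ℝ) • (h + k))) ≤ 0 :=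
        mul_nonpos_of_nonneg_of_nonpos hC0 (by linarith)
      linarith
    have hlim : Tendsto (fun ε : ℝ => ε * (dirichletSum G p h + dirichletSum G p k)) (𝓝[>] 0)
        (𝓝 (0 * (dirichletSum G p h + dirichletSum G p k))) :=
      (tendsto_id.mul_const _).mono_left nhdsWithin_le_nhds
    rw [zero_mul] at hlim
    refine ge_of_tendsto hlim ?_
    filter_upwards [self_mem_nhdsWithin] with ε hε using key ε hε
  rw [energy_eq_ofReal ((BD G p hp).sub_mem hh.2 hk.2).1]
  exact ENNReal.ofReal_eq_zero.2 h4

/-! ### The Royden decomposition. -/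

lemma abs_clamp_sub_clamp_le (a b s t : ℝ) :
    |max a (min b s) - max a (min b t)| ≤ |s - t| :=
  (abs_max_sub_max_le_max _ _ _ _).trans (max_le (by simp)
    ((abs_min_sub_min_le_max _ _ _ _).trans (max_le (by simp) le_rfl)))

/-- Along a bounded sequence of competitors whose energies tend to the infimum, energies of
differences become small. -/
lemma exists_dirichletSum_sub_lt (hp : 1 < p) {g : ℕ → V → ℝ} (hg : ∀ n, g n ∈ BD G p hp)
    {m : ℝ} (hm : ∀ n k, m ≤ dirichletSum G p ((1 / 2 : ℝ) • (g n + g k)))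
    (hlim : Tendsto (fun n => dirichletSum G p (g n)) atTop (𝓝 m)) {η : ℝ} (hη : 0 < η) :
    ∃ N, ∀ n ≥ N, ∀ k ≥ N, dirichletSum G p (g n - g k) ≤ η := by
  have hm0 : 0 ≤ m := ge_of_tendsto hlim (Eventually.of_forall fun _ => dirichletSum_nonneg _)
  -- Once both energies are below `m + δ` with `δ ≤ 1`, their sum is at most `2 * m + 2` and the
  -- convexity gap is at most `δ`; each term then contributes at most `η / 2`. The `C + 1` below
  -- keeps the denominator positive when `C = 0`.
  let ε := η / (2 * (2 * m + 2))
  have hε : 0 < ε := by positivity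
  obtain ⟨C, hC0, hC⟩ := exists_dirichletSum_sub_le (G := G) hp hε
  let δ := min 1 (η / (2 * (C + 1)))
  have hδ : 0 < δ := by positivity
  obtain ⟨N, hN⟩ := eventually_atTop.1 (hlim.eventually (gt_mem_nhds (lt_add_of_pos_right m hδ)))
  refine ⟨N, fun n hn k hk => (hC _ (hg n) _ (hg k)).trans ?_⟩
  have h1 := hN n hn
  have h2 := hN k hk
  have h3 := hm n k
  have hδ1 : δ ≤ 1 := min_le_left _ _
  have hδ2 : δ ≤ η / (2 * (C + 1)) := min_le_right _ _
  have h4 : ε * (dirichletSum G p (g n) + dirichletSum G p (g k)) ≤ η / 2 := by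
    calc _ ≤ ε * (2 * m + 2) := mul_le_mul_of_nonneg_left (by linarith) hε.le
      _ = η / 2 := by simp only [ε]; field_simp
  have h5 : C * ((dirichletSum G p (g n) + dirichletSum G p (g k)) / 2 -
      dirichletSum G p ((1 / 2 : ℝ) • (g n + g k))) ≤ η / 2 := by
    calc _ ≤ C * δ := mul_le_mul_of_nonneg_left (by linarith) hC0
      _ ≤ (C + 1) * (η / (2 * (C + 1))) :=
        mul_le_mul (by linarith) hδ2 hδ.le (by linarith)
      _ = η / 2 := by field_simp
  linarith

/-- Truncation at a bound for `f` does not alter `f` where `u` vanishes, so truncated competitors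
are still finitely supported perturbations of `f`. -/
lemma support_clamp_add_sub_subset {f u : V → ℝ} {M : ℝ} (hM : ∀ x, |f x| ≤ M) :
    Function.support (fun x => max (-M) (min M (f x + u x)) - f x) ⊆ Function.support u := by
  intro x hx hux
  refine hx ?_
  have h := abs_le.1 (hM x)
  simp only at hux ⊢
  rw [hux, add_zero, min_eq_right h.2, max_eq_right h.1, sub_self]

/-- The Royden decomposition: every function in `BD` has a harmonic projection. -/
lemma exists_isHarmonicProjection [Countable V] (hp : 1 < p) (o : V)
    {f : V → ℝ} (hf : f ∈ BD G p hp) : ∃ h, IsHarmonicProjection G p hp o f h := by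
  have hp0 : 0 < p := by linarith
  obtain ⟨M, hM⟩ := hf.2
  have hM0 : 0 ≤ M := (abs_nonneg _).trans (hM o)
  let S : Set ℝ≥0∞ := (fun u => energy G p (f + u)) '' {u : V → ℝ | (Function.support u).Finite}
  have hS : S.Nonempty := ⟨_, 0, by simp, rfl⟩
  let m := sInf S
  have hmle : ∀ u : V → ℝ, (Function.support u).Finite → m ≤ energy G p (f + u) :=
    fun u hu => sInf_le ⟨u, hu, rfl⟩
  have hmtop : m ≠ ⊤ := by
    have h := hmle 0 (by simp)
    rw [add_zero] at h
    exact ne_top_of_le_ne_top (dirichletFinite_iff_energy_ne_top.1 hf.1) h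
  obtain ⟨e, -, helim, heS⟩ := exists_seq_tendsto_sInf hS (OrderBot.bddBelow S)
  choose u hu hue using heS
  -- Truncation does not increase the energy, so the sequence remains minimizing, and it becomes
  -- uniformly bounded.
  let g : ℕ → V → ℝ := fun n x => max (-M) (min M (f x + u n x))
  let v : ℕ → V → ℝ := fun n => g n - f
  have hv : ∀ n, (Function.support (v n)).Finite := fun n =>
    (hu n).subset (support_clamp_add_sub_subset hM)
  have hgv : ∀ n, g n = f + v n := fun n => by simp [v]
  have hgBD : ∀ n, g n ∈ BD G p hp := fun n => by
    rw [hgv]; exact (BD G p hp).add_mem hf (mem_BD_of_finite_support hp (hv n))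
  have hgM : ∀ n x, g n x ∈ Set.Icc (-M) M := fun n x =>
    ⟨le_max_left _ _, max_le (by linarith) (min_le_left _ _)⟩
  have hglim : Tendsto (fun n => energy G p (g n)) atTop (𝓝 m) := by
    refine tendsto_of_tendsto_of_tendsto_of_le_of_le tendsto_const_nhds helim
      (fun n => ?_) (fun n => ?_)
    · rw [hgv]; exact hmle _ (hv n)
    · rw [← hue n]
      exact energy_le_energy hp0.le fun x y _ => abs_clamp_sub_clamp_le _ _ _ _
  have hgreal : Tendsto (fun n => dirichletSum G p (g n)) atTop (𝓝 m.toReal) := by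
    simpa [Function.comp_def, toReal_energy] using (ENNReal.tendsto_toReal hmtop).comp hglim
  have hmid : ∀ n k, m.toReal ≤ dirichletSum G p ((1 / 2 : ℝ) • (g n + g k)) := by
    intro n k
    have hBD := (BD G p hp).smul_mem ((BD G p hp).add_mem (hgBD n) (hgBD k)) (1 / 2 : ℝ)
    rw [← toReal_energy]
    refine ENNReal.toReal_mono (dirichletFinite_iff_energy_ne_top.1 hBD.1) ?_
    have : (1 / 2 : ℝ) • (g n + g k) = f + (1 / 2 : ℝ) • (v n + v k) := by
      rw [hgv, hgv]; funext x
      simp only [Pi.smul_apply, Pi.add_apply, smul_eq_mul]; ring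
    rw [this]
    exact hmle _ ((((hv n).union (hv k)).subset (Function.support_add _ _)).subset
      (Function.support_const_smul_subset _ _))
  -- The cube `[-M, M] ^ V` is compact and, as `V` is countable, first countable, so a subsequence
  -- converges pointwise.
  obtain ⟨h, hhM, σ, hσ, hσlim⟩ :=
    (isCompact_univ_pi fun _ : V => isCompact_Icc (a := -M) (b := M)).tendsto_subseq
      (x := g) fun n x _ => hgM n x
  have hpt : ∀ x, Tendsto (fun n => g (σ n) x) atTop (𝓝 (h x)) := fun x =>
    (tendsto_pi_nhds.1 hσlim) x
  -- The sequence is Cauchy in energy by uniform convexity; Fatou's lemma in the second index turns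
  -- this into convergence in energy to the pointwise limit.
  have hgh : Tendsto (fun n => energy G p (g n - h)) atTop (𝓝 0) := by
    rw [ENNReal.tendsto_atTop_zero]
    intro η hη
    obtain ⟨η', hη'0, hη'⟩ := ENNReal.lt_iff_exists_real_btwn.1 hη
    have hη'pos : 0 < η' := ENNReal.ofReal_pos.1 hη'.1
    obtain ⟨N, hN⟩ := exists_dirichletSum_sub_lt hp hgBD hmid hgreal hη'pos
    refine ⟨N, fun n hn => ?_⟩
    refine energy_le_of_tendsto hp0.le (l := atTop) (f := fun k => g n - g (σ k))
      (fun x => tendsto_const_nhds.sub (hpt x)) ?_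
    filter_upwards [eventually_ge_atTop N] with k hk
    rw [energy_eq_ofReal ((BD G p hp).sub_mem (hgBD n) (hgBD (σ k))).1]
    exact (ENNReal.ofReal_le_ofReal (hN n hn _ (hk.trans (hσ.id_le k)))).trans hη'.2.le
  have hhm : energy G p h ≤ m := by
    refine ENNReal.le_of_forall_pos_le_add fun δ hδ _ => ?_
    refine energy_le_of_tendsto hp0.le (l := atTop) hpt ?_
    exact (hglim.comp hσ.tendsto_atTop).eventually
      (Iic_mem_nhds (ENNReal.lt_add_right hmtop (by simpa using hδ.ne')))
  have hhBD : h ∈ BD G p hp := by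
    refine ⟨dirichletFinite_iff_energy_ne_top.2 (ne_top_of_le_ne_top hmtop hhm), M, fun x => ?_⟩
    exact abs_le.2 (hhM x (Set.mem_univ x))
  refine ⟨h, hf, ⟨isPHarmonic_of_forall_energy_le hp hhBD fun w hw => hhm.trans ?_, hhBD⟩, ?_⟩
  · refine le_energy_of_tendsto hp.le (l := atTop) (f := fun n => g n + w) (fun n => ?_)
      (hgh.congr fun n => by rw [add_sub_add_right_eq_sub])
    rw [hgv, add_assoc]
    exact hmle _ (((hv n).union hw).subset (Function.support_add _ _))
  -- The approximants of `f - h` are `f - g (σ n) = -v (σ n)`, which have finite support.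
  · refine mem_BD0_of_tendsto hp ((BD G p hp).sub_mem hf hhBD) (l := atTop)
      (u := fun n => -v (σ n)) (fun n => by rw [Function.support_neg]; exact hv _) ?_ ?_
    · refine (hgh.comp hσ.tendsto_atTop).congr fun n => ?_
      simp only [Function.comp_apply]
      congr 1
      rw [hgv]; ring
    · have := (tendsto_const_nhds (x := f o)).sub (hpt o)
      refine this.congr fun n => ?_
      simp [v]

/-! ### The alternative `1 ∈ BD0` or `1 ∉ BD0`, and uniqueness of projections. -/

/-- If `1 ∈ BD0`, then `BD0` is all of `BD`. -/
lemma mem_BD0_of_one_mem (hG : G.Connected) (hp : 1 < p) {o : V}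
    (h1 : (fun _ => 1) ∈ BD0 G p hp o) {f : V → ℝ} (hf : f ∈ BD G p hp) :
    f ∈ BD0 G p hp o := by
  have hp0 : 0 < p := by linarith
  obtain ⟨M, hM⟩ := hf.2
  have hM0 : 0 ≤ M := (abs_nonneg _).trans (hM o)
  obtain ⟨u, hu, hue, hux⟩ := exists_seq_of_mem_BD0 hG hp h1
  -- Finitely supported cut-offs with values in `[0, 1]`, tending to `1` pointwise and to zero in
  -- energy. The functions `f * w n` will approximate `f`.
  let w : ℕ → V → ℝ := fun n x => max 0 (min 1 (u n x))
  have hw0 : ∀ n x, 0 ≤ w n x := fun n x => le_max_left _ _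
  have hw1 : ∀ n x, w n x ≤ 1 := fun n x => max_le zero_le_one (min_le_left _ _)
  have hwsupp : ∀ n, (Function.support (w n)).Finite := fun n =>
    (hu n).subset fun x hx hux => hx (by
      have h0 : u n x = 0 := hux
      simp [w, h0])
  have hwx : ∀ x, Tendsto (fun n => w n x) atTop (𝓝 1) := fun x => by
    have := (tendsto_const_nhds (x := (0 : ℝ))).max
      ((tendsto_const_nhds (x := (1 : ℝ))).min (hux x))
    simpa using this
  have hwe : Tendsto (fun n => energy G p (w n)) atTop (𝓝 0) := by
    refine tendsto_of_tendsto_of_tendsto_of_le_of_le tendsto_const_nhds hue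
      (fun _ => zero_le) fun n => energy_le_energy hp0.le fun x y _ => ?_
    refine (abs_clamp_sub_clamp_le _ _ _ _).trans_eq ?_
    simp only [Pi.sub_apply]
    rw [abs_sub_comm]; congr 1; ring
  refine mem_BD0_of_tendsto hp hf (l := atTop) (u := fun n => f * w n)
    (fun n => (hwsupp n).subset (Function.support_mul_subset_right _ _)) ?_ ?_
  swap
  · simpa using (hwx o).const_mul (f o)
  let A := (1 / 2 : ℝ) ^ (1 - p)
  let B := (1 - 1 / 2 : ℝ) ^ (1 - p)
  have hA : 0 ≤ A := by positivity
  have hB : 0 ≤ B := by positivity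
  -- The increments of `f * (1 - w n)` split by the product rule: one part is bounded by `M` times
  -- those of `w n`, the other is the gradient of `f` weighted by `1 - w n`. The energy of the
  -- second part is controlled by `D n`, which tends to zero by dominated convergence.
  let D : ℕ → ℝ := fun n => ∑' x, |1 - w n x| ^ p * gradPow G p f x
  have hterm : ∀ n x, |1 - w n x| ^ p * gradPow G p f x ≤ gradPow G p f x := fun n x => by
    refine mul_le_of_le_one_left (gradPow_nonneg ..) (Real.rpow_le_one (abs_nonneg _) ?_ hp0.le)
    rw [abs_le]
    constructor <;> linarith [hw0 n x, hw1 n x]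
  have hnn : ∀ n x, 0 ≤ |1 - w n x| ^ p * gradPow G p f x := fun n x =>
    mul_nonneg (Real.rpow_nonneg (abs_nonneg _) _) (gradPow_nonneg ..)
  have hDsum : ∀ n, Summable fun x => |1 - w n x| ^ p * gradPow G p f x := fun n =>
    Summable.of_nonneg_of_le (hnn n) (hterm n) hf.1
  have hD : Tendsto D atTop (𝓝 0) := by
    have := tendsto_tsum_of_dominated_convergence (𝓕 := atTop)
      (f := fun n x => |1 - w n x| ^ p * gradPow G p f x) (g := fun _ => (0 : ℝ)) hf.1
      (fun x => ?_) (Eventually.of_forall fun n x => ?_)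
    · simpa using this
    · have h2 := ((tendsto_const_nhds (x := (1 : ℝ))).sub (hwx x)).abs.rpow_const (p := p)
        (Or.inr hp0.le)
      simpa [Real.zero_rpow hp0.ne'] using h2.mul_const (gradPow G p f x)
    · rw [Real.norm_of_nonneg (hnn n x)]
      exact hterm n x
  have hwreal : Tendsto (fun n => dirichletSum G p (w n)) atTop (𝓝 0) := by
    simpa [Function.comp_def, toReal_energy] using
      (ENNReal.tendsto_toReal ENNReal.zero_ne_top).comp hwe
  have hwfin : ∀ n, DirichletFinite G p (w n) := fun n =>
    dirichletFinite_of_finite_support hp0 (hwsupp n)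
  have hfw : ∀ n, f - f * w n ∈ BD G p hp := fun n => (BD G p hp).sub_mem hf
    ((BD G p hp).mul_mem hf (mem_BD_of_finite_support hp (hwsupp n)))
  have hle : ∀ n, dirichletSum G p (f - f * w n) ≤
      A * (M ^ p * dirichletSum G p (w n)) + B * D n := by
    intro n
    refine hasSum_le (fun x => ?_) (hfw n).1.hasSum
      ((((hwfin n).hasSum.mul_left (M ^ p)).mul_left A).add ((hDsum n).hasSum.mul_left B))
    unfold gradPow
    simp only [Finset.mul_sum]
    rw [← Finset.sum_add_distrib]
    refine Finset.sum_le_sum fun y _ => ?_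
    have e1 : (f - f * w n) y - (f - f * w n) x =
        -(f y * (w n y - w n x)) + (1 - w n x) * (f y - f x) := by
      simp only [Pi.sub_apply, Pi.mul_apply]; ring
    have h2 : |(f - f * w n) y - (f - f * w n) x| ≤
        M * |w n y - w n x| + |1 - w n x| * |f y - f x| := by
      rw [e1]
      refine (abs_add_le _ _).trans ?_
      rw [abs_neg, abs_mul, abs_mul]
      exact add_le_add_left (mul_le_mul_of_nonneg_right (hM y) (abs_nonneg _)) _
    refine (Real.rpow_le_rpow (abs_nonneg _) h2 hp0.le).trans ?_
    refine (add_rpow_le_weighted hp.le (r := 1 / 2) (by positivity) (by positivity)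
      (by norm_num) (by norm_num)).trans_eq ?_
    rw [Real.mul_rpow hM0 (abs_nonneg _), Real.mul_rpow (abs_nonneg _) (abs_nonneg _)]
  have hlim : Tendsto (fun n => dirichletSum G p (f - f * w n)) atTop (𝓝 0) := by
    refine squeeze_zero (fun _ => dirichletSum_nonneg _) hle ?_
    simpa using ((hwreal.const_mul (M ^ p)).const_mul A).add (hD.const_mul B)
  have := (ENNReal.continuous_ofReal.tendsto _).comp hlim
  rw [ENNReal.ofReal_zero] at this
  exact this.congr fun n => (energy_eq_ofReal (hfw n).1).symm

lemma const_mem_BHD (hp : 1 < p) (c : ℝ) : (fun _ => c) ∈ BHD G p hp :=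
  ⟨fun x => by simp [pLaplacian], (BD G p hp).algebraMap_mem c⟩

/-- If `1 ∈ BD0`, then every function in `BHD` is constant. -/
lemma BHD.eq_of_one_mem (hG : G.Connected) (hp : 1 < p) {o : V}
    (h1 : (fun _ => 1) ∈ BD0 G p hp o) {h : V → ℝ} (hh : h ∈ BHD G p hp) (x y : V) :
    h x = h y := by
  have h2 := BHD.energy_sub_eq_zero hG hp hh (const_mem_BHD hp 0)
    (mem_BD0_of_one_mem hG hp h1 ((BD G p hp).sub_mem hh.2 (const_mem_BHD hp 0).2))
  simpa using eq_of_energy_eq_zero hG (by linarith) h2 x y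

/-- If `1 ∉ BD0`, then harmonic projections are unique. -/
lemma IsHarmonicProjection.unique (hG : G.Connected) (hp : 1 < p) {o : V}
    (h1 : (fun _ => 1) ∉ BD0 G p hp o) {f g h : V → ℝ}
    (hg : IsHarmonicProjection G p hp o f g) (hh : IsHarmonicProjection G p hp o f h) :
    g = h := by
  have h0 : g - h ∈ BD0 G p hp o := by
    have := sub_mem_BD0 hG hp hh.2.2 hg.2.2
    rwa [sub_sub_sub_cancel_left] at this
  have h2 := eq_of_energy_eq_zero hG (by linarith) (BHD.energy_sub_eq_zero hG hp hg.2.1 hh.2.1 h0)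
  by_contra hne
  have h3 : (g - h) o ≠ 0 := fun hz => hne (by
    funext x
    have := h2 x o
    rw [hz] at this
    exact sub_eq_zero.1 this)
  -- The difference is a nonzero constant in `BD0`; rescaling it would put `1` in `BD0`.
  refine h1 ?_
  convert const_smul_mem_BD0 hG hp ((g - h) o)⁻¹ h0 using 1
  funext x
  rw [Pi.smul_apply, h2 x o, smul_eq_mul, inv_mul_cancel₀ h3]

end

/-! ### Rough isometries, bounded fibres and counting in graphs of bounded degree. -/

section

variable {V W : Type*} {G : SimpleGraph V} {H : SimpleGraph W} {p : ℝ}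

/-- Two points with nearby images under a rough isometry are near. -/
lemma IsRoughIsometryWith.dist_le {a b c : ℝ} {φ : V → W}
    (h : IsRoughIsometryWith G H a b c φ) (x y : V) :
    (G.dist x y : ℝ) ≤ a * (H.dist (φ x) (φ y) + b) := by
  obtain ⟨ha, -, -, hd, -⟩ := h
  have h1 := (hd x y).1
  have ha0 : 0 < a := by linarith
  rw [one_div_mul_eq_div, sub_le_iff_le_add, div_le_iff₀ ha0] at h1
  linarith

lemma IsRoughIsometry.exists_isRoughInverse (hH : H.Connected) {φ : V → W}
    (hφ : IsRoughIsometry G H φ) : ∃ ψ : W → V, IsRoughInverse G H φ ψ := by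
  obtain ⟨a, b, c, h⟩ := hφ
  have ⟨ha, hb, hc, hd, hs⟩ := h
  have ha0 : 0 < a := by linarith
  choose ψ hψ using hs
  have tri : ∀ x y z, (H.dist x z : ℝ) ≤ H.dist x y + H.dist y z := fun x y z => by
    exact_mod_cast hH.dist_triangle
  have hback : ∀ x, (G.dist (ψ (φ x)) x : ℝ) ≤ a * (c + b) := fun x =>
    (h.dist_le _ _).trans (mul_le_mul_of_nonneg_left (by linarith [hψ (φ x)]) ha0.le)
  -- Passing between `y`, `z` and `φ (ψ y)`, `φ (ψ z)` costs at most `2 * c`; with the additive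
  -- error `b`, multiplied by `a` on pulling back, this gives the new additive constant. The `+ 1`
  -- is there because coarse density asks for a strict inequality.
  refine ⟨ψ, ⟨a, a * (2 * c + b), a * (c + b) + 1, ha, by positivity, by positivity,
    fun y z => ⟨?_, ?_⟩, fun x => ⟨φ x, by linarith [hback x]⟩⟩, a, b, c, h, hback,
    fun y => (hψ y).le⟩
  · have h1 := tri y (φ (ψ y)) z
    have h2 := tri (φ (ψ y)) (φ (ψ z)) z
    have h3 := (hd (ψ y) (ψ z)).2
    have h4 := hψ y
    have h5 := hψ z
    rw [SimpleGraph.dist_comm] at h4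
    have h6 : (H.dist y z : ℝ) ≤ a * (G.dist (ψ y) (ψ z)) + (2 * c + b) := by linarith
    rw [one_div_mul_eq_div, sub_le_iff_le_add, div_le_iff₀ ha0]
    have h7 : 2 * c + b ≤ a * (2 * c + b) * a := by
      have h8 : 1 ≤ a * a := by nlinarith
      nlinarith
    linarith
  · have h1 := tri (φ (ψ y)) y (φ (ψ z))
    have h2 := tri y z (φ (ψ z))
    have h4 := hψ y
    have h5 := hψ z
    rw [SimpleGraph.dist_comm] at h5
    refine (h.dist_le _ _).trans ?_
    rw [← mul_add]
    exact mul_le_mul_of_nonneg_left (by linarith) ha0.le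

/-- The fibres of `θ` are finite, of bounded size. -/
def HasBoundedFibers (θ : V → W) : Prop :=
  ∃ N : ℕ, ∀ w, ∃ s : Finset V, s.card ≤ N ∧ ∀ x, θ x = w → x ∈ s

lemma hasBoundedFibers_id : HasBoundedFibers (id : V → V) :=
  ⟨1, fun w => ⟨{w}, by simp, by simp⟩⟩

lemma HasBoundedFibers.finite_preimage {θ : V → W} (hθ : HasBoundedFibers θ) {S : Set W}
    (hS : S.Finite) : (θ ⁻¹' S).Finite := by
  obtain ⟨N, hN⟩ := hθ
  refine hS.preimage' fun w _ => ?_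
  obtain ⟨s, -, hs⟩ := hN w
  exact s.finite_toSet.subset fun x hx => hs x hx

lemma HasBoundedFibers.exists_tsum_comp_le {θ : V → W} (hθ : HasBoundedFibers θ) :
    ∃ N : ℕ, ∀ e : W → ℝ≥0∞, ∑' x, e (θ x) ≤ N * ∑' w, e w := by
  classical
  obtain ⟨N, hN⟩ := hθ
  refine ⟨N, fun e => ?_⟩
  -- Writing each term as a sum over `w` allows the two sums to be exchanged, so that each `e w` is
  -- counted once for each point of its fibre.
  have h1 : ∀ x, e (θ x) = ∑' w, if w = θ x then e w else 0 := fun x =>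
    (tsum_ite_eq (θ x) (fun w => e w)).symm
  simp only [h1]
  rw [ENNReal.tsum_comm, ← ENNReal.tsum_mul_left]
  refine ENNReal.tsum_le_tsum fun w => ?_
  obtain ⟨s, hs, hsw⟩ := hN w
  rw [tsum_eq_sum (s := s) fun x hx => if_neg fun h => hx (hsw x h.symm)]
  calc ∑ x ∈ s, (if w = θ x then e w else 0) ≤ ∑ _x ∈ s, e w :=
        Finset.sum_le_sum fun x _ => by split_ifs <;> simp
    _ = s.card * e w := by rw [Finset.sum_const, nsmul_eq_mul]
    _ ≤ N * e w := by gcongr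

/-- A map that is coarsely Lipschitz with fibres of bounded size. -/
def IsTame (G : SimpleGraph V) (H : SimpleGraph W) (φ : V → W) : Prop :=
  HasBoundedFibers φ ∧ ∃ R : ℕ, ∀ x y, G.Adj x y → H.dist (φ x) (φ y) ≤ R

variable [G.LocallyFinite]

/-- Double counting: by symmetry of adjacency, `e y` occurs `G.degree y` times. -/
lemma tsum_sum_neighborFinset_le {k : ℕ} (hk : ∀ x, G.degree x ≤ k) (e : V → ℝ≥0∞) :
    ∑' x, ∑ y ∈ G.neighborFinset x, e y ≤ k * ∑' x, e x := by
  classical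
  have h1 : ∀ x, ∑ y ∈ G.neighborFinset x, e y = ∑' y, if G.Adj x y then e y else 0 := by
    intro x
    rw [tsum_eq_sum (s := G.neighborFinset x)
      fun y hy => if_neg fun h => hy ((G.mem_neighborFinset x y).2 h)]
    exact Finset.sum_congr rfl fun y hy => (if_pos ((G.mem_neighborFinset x y).1 hy)).symm
  have h2 : ∀ y, ∑' x, (if G.Adj x y then e y else 0) = G.degree y * e y := by
    intro y
    rw [tsum_eq_sum (s := G.neighborFinset y)
      fun x hx => if_neg fun h => hx ((G.mem_neighborFinset y x).2 h.symm),
      Finset.sum_congr rfl fun x hx => if_pos ((G.mem_neighborFinset y x).1 hx).symm,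
      Finset.sum_const, G.card_neighborFinset_eq_degree, nsmul_eq_mul]
  simp only [h1]
  rw [ENNReal.tsum_comm, ← ENNReal.tsum_mul_left]
  refine ENNReal.tsum_le_tsum fun y => ?_
  rw [h2]
  gcongr
  exact hk y

/-- Differences of `f` over bounded distances are controlled by a summable function whose sum is
bounded by the energy of `f`. -/
lemma exists_bound_of_walk_length_le (hp : 1 ≤ p) {k : ℕ} (hk : ∀ x, G.degree x ≤ k) (R : ℕ) :
    ∃ C : ℝ≥0∞, C ≠ ⊤ ∧ ∀ f : V → ℝ, ∃ e : V → ℝ≥0∞, ∑' x, e x ≤ C * energy G p f ∧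
      ∀ x y, ∀ w : G.Walk x y, w.length ≤ R → ENNReal.ofReal (|f y - f x| ^ p) ≤ e x := by
  have hp0 : p ≠ 0 := by linarith
  induction R with
  | zero =>
    refine ⟨0, ENNReal.zero_ne_top, fun f => ⟨0, by simp, fun x y w hw => ?_⟩⟩
    obtain rfl := SimpleGraph.Walk.eq_of_length_eq_zero (Nat.le_zero.1 hw)
    simp [Real.zero_rpow hp0]
  | succ R ih =>
    obtain ⟨C, hC, hCf⟩ := ih
    -- The constant `2 ^ (p - 1)` for a sum of two terms. A longer walk is cut after its first step:
    -- that step is paid for by `gradPow`, the remainder by the old bound at the neighbour reached.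
    let c : ℝ := (1 / 2 : ℝ) ^ (1 - p)
    have hc : 0 ≤ c := by positivity
    refine ⟨ENNReal.ofReal c * (1 + k * C), ENNReal.mul_ne_top ENNReal.ofReal_ne_top
      (ENNReal.add_ne_top.2 ⟨ENNReal.one_ne_top, ENNReal.mul_ne_top (by simp) hC⟩), fun f => ?_⟩
    obtain ⟨e, he, hef⟩ := hCf f
    refine ⟨fun x => ENNReal.ofReal c *
      (ENNReal.ofReal (gradPow G p f x) + ∑ z ∈ G.neighborFinset x, e z), ?_, ?_⟩
    · rw [ENNReal.tsum_mul_left, ENNReal.tsum_add, mul_assoc]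
      gcongr
      rw [add_mul, one_mul, mul_assoc]
      refine add_le_add le_rfl ((tsum_sum_neighborFinset_le hk e).trans ?_)
      gcongr
    · intro x y w hw
      cases w with
      | nil => simp [Real.zero_rpow hp0]
      | @cons _ z _ hadj w =>
        have hmem := (G.mem_neighborFinset x z).2 hadj
        have h1 : |f y - f x| ^ p ≤ c * (|f z - f x| ^ p + |f y - f z| ^ p) := by
          have h2 : |f y - f x| ≤ |f z - f x| + |f y - f z| := by
            have := abs_add_le (f z - f x) (f y - f z)
            rwa [sub_add_sub_comm, add_comm (f z), add_sub_add_right_eq_sub] at this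
          refine (Real.rpow_le_rpow (abs_nonneg _) h2 (by linarith)).trans ?_
          refine (add_rpow_le_weighted hp (r := 1 / 2) (abs_nonneg _) (abs_nonneg _)
            (by norm_num) (by norm_num)).trans_eq ?_
          rw [mul_add, show (1 - 1 / 2 : ℝ) = 1 / 2 by norm_num]
        refine (ENNReal.ofReal_le_ofReal h1).trans ?_
        rw [ENNReal.ofReal_mul hc, ENNReal.ofReal_add (by positivity) (by positivity)]
        beta_reduce
        gcongr
        · exact Finset.single_le_sum (f := fun y => |f y - f x| ^ p)
            (fun _ _ => Real.rpow_nonneg (abs_nonneg _) _) hmem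
        · refine (hef z y w ?_).trans (Finset.single_le_sum (f := e) (fun _ _ => zero_le) hmem)
          simpa using hw

lemma exists_finset_of_walk_length_le {k : ℕ} (hk : ∀ x, G.degree x ≤ k) (R : ℕ) :
    ∃ N : ℕ, ∀ x, ∃ s : Finset V, s.card ≤ N ∧ ∀ y, ∀ w : G.Walk x y, w.length ≤ R → y ∈ s := by
  classical
  induction R with
  | zero =>
    refine ⟨1, fun x => ⟨{x}, by simp, fun y w hw => ?_⟩⟩
    obtain rfl := SimpleGraph.Walk.eq_of_length_eq_zero (Nat.le_zero.1 hw)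
    simp
  | succ R ih =>
    obtain ⟨N, hN⟩ := ih
    choose s hs hsw using hN
    refine ⟨k * N + 1, fun x => ⟨insert x ((G.neighborFinset x).biUnion s), ?_, ?_⟩⟩
    · refine (Finset.card_insert_le _ _).trans (Nat.succ_le_succ ?_)
      refine (Finset.card_biUnion_le_card_mul _ _ N fun z _ => hs z).trans ?_
      rw [G.card_neighborFinset_eq_degree]
      exact Nat.mul_le_mul_right N (hk x)
    · intro y w hw
      cases w with
      | nil => exact Finset.mem_insert_self _ _
      | @cons _ z _ hadj w =>
        refine Finset.mem_insert_of_mem (Finset.mem_biUnion.2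
          ⟨z, (G.mem_neighborFinset x z).2 hadj, hsw z y w ?_⟩)
        simpa using hw

lemma IsRoughIsometry.isTame (hG : G.Connected) {k : ℕ} (hk : ∀ x, G.degree x ≤ k) {φ : V → W}
    (hφ : IsRoughIsometry G H φ) : IsTame G H φ := by
  classical
  obtain ⟨a, b, c, h⟩ := hφ
  constructor
  -- Points with the same image are at distance at most `a * b`, so a fibre lies in a ball of fixed
  -- radius, and such balls have bounded size.
  · obtain ⟨N, hN⟩ := exists_finset_of_walk_length_le hk ⌈a * b⌉₊
    refine ⟨N, fun w => ?_⟩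
    by_cases hw : ∃ x, φ x = w
    · obtain ⟨x, rfl⟩ := hw
      obtain ⟨s, hs, hsw⟩ := hN x
      refine ⟨s, hs, fun y hy => ?_⟩
      obtain ⟨w, hw⟩ := hG.exists_walk_length_eq_dist x y
      refine hsw y w ?_
      have h1 := h.dist_le x y
      rw [hy, SimpleGraph.dist_self, Nat.cast_zero, zero_add] at h1
      rw [hw]
      exact_mod_cast h1.trans (Nat.le_ceil _)
    · exact ⟨∅, by simp, fun x hx => (hw ⟨x, hx⟩).elim⟩
  · refine ⟨⌈a + b⌉₊, fun x y hxy => ?_⟩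
    have h1 := (h.2.2.2.1 x y).2
    rw [SimpleGraph.dist_eq_one_iff_adj.2 hxy, Nat.cast_one, mul_one] at h1
    exact_mod_cast h1.trans (Nat.le_ceil _)

/-! ### Composition with tame maps on `BD` and `BD0`. -/

variable [H.LocallyFinite]

/-- A bounded `p`-summable function belongs to `BD0`. -/
lemma mem_BD0_of_tsum_ne_top (hp : 1 < p) {k : ℕ} (hk : ∀ x, G.degree x ≤ k) {o : V}
    {f : V → ℝ} (hb : IsBdd f) (hf : ∑' x, ENNReal.ofReal (|f x| ^ p) ≠ ⊤) :
    f ∈ BD0 G p hp o := by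
  classical
  have hp0 : 0 < p := by linarith
  let c : ℝ := (1 / 2 : ℝ) ^ (1 - p)
  have hc : 0 ≤ c := by positivity
  let C : ℝ≥0∞ := ENNReal.ofReal c * (k + k)
  have hC : C ≠ ⊤ := ENNReal.mul_ne_top ENNReal.ofReal_ne_top (by simp)
  have hen : ∀ g : V → ℝ, energy G p g ≤ C * ∑' x, ENNReal.ofReal (|g x| ^ p) := by
    intro g
    have h1 : ∀ x, ENNReal.ofReal (gradPow G p g x) ≤ ENNReal.ofReal c *
        (∑ y ∈ G.neighborFinset x, ENNReal.ofReal (|g y| ^ p) +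
          k * ENNReal.ofReal (|g x| ^ p)) := by
      intro x
      unfold gradPow
      rw [ENNReal.ofReal_sum_of_nonneg fun _ _ => Real.rpow_nonneg (abs_nonneg _) _]
      calc ∑ y ∈ G.neighborFinset x, ENNReal.ofReal (|g y - g x| ^ p)
          ≤ ∑ y ∈ G.neighborFinset x, ENNReal.ofReal c *
            (ENNReal.ofReal (|g y| ^ p) + ENNReal.ofReal (|g x| ^ p)) := by
            refine Finset.sum_le_sum fun y _ => ?_
            rw [← ENNReal.ofReal_add (by positivity) (by positivity), ← ENNReal.ofReal_mul hc]
            refine ENNReal.ofReal_le_ofReal ?_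
            refine (Real.rpow_le_rpow (abs_nonneg _) (abs_sub (g y) (g x)) hp0.le).trans ?_
            refine (add_rpow_le_weighted hp.le (r := 1 / 2) (abs_nonneg _) (abs_nonneg _)
              (by norm_num) (by norm_num)).trans_eq ?_
            rw [mul_add, show (1 - 1 / 2 : ℝ) = 1 / 2 by norm_num]
        _ ≤ _ := by
            rw [← Finset.mul_sum, Finset.sum_add_distrib, Finset.sum_const,
              G.card_neighborFinset_eq_degree, nsmul_eq_mul]
            gcongr
            exact hk x
    refine (ENNReal.tsum_le_tsum h1).trans ?_
    rw [ENNReal.tsum_mul_left, ENNReal.tsum_add, ENNReal.tsum_mul_left, mul_assoc, add_mul]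
    gcongr
    exact tsum_sum_neighborFinset_le hk _
  have hBD : f ∈ BD G p hp := ⟨dirichletFinite_iff_energy_ne_top.2
    (ne_top_of_le_ne_top (ENNReal.mul_ne_top hC hf) (hen f)), hb⟩
  -- Restrictions to finite sets: the error is a tail of the convergent sum, since energy is bounded
  -- by a multiple of the `p`-sum.
  let u : Finset V → V → ℝ := fun s x => if x ∈ s then f x else 0
  refine mem_BD0_of_tendsto hp hBD (l := atTop) (u := u) (fun s => ?_) ?_ ?_
  · refine s.finite_toSet.subset fun x hx => ?_
    by_contra hxs
    exact hx (if_neg hxs)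
  · have h1 := ENNReal.Tendsto.const_mul (a := C) (ENNReal.tendsto_tsum_compl_atTop_zero hf)
      (Or.inr hC)
    rw [mul_zero] at h1
    refine tendsto_of_tendsto_of_tendsto_of_le_of_le tendsto_const_nhds h1 (fun _ => zero_le)
      fun s => (hen _).trans ?_
    gcongr
    have h2 := tsum_subtype {x | x ∉ s} fun x => ENNReal.ofReal (|f x| ^ p)
    refine le_of_le_of_eq ?_ h2.symm
    refine ENNReal.tsum_le_tsum fun x => ?_
    by_cases hx : x ∈ s
    · simp [u, hx, Real.zero_rpow hp0.ne']
    · simp [u, hx]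
  · refine tendsto_const_nhds.congr' ?_
    filter_upwards [eventually_ge_atTop {o}] with s hs
    exact (if_pos (hs (Finset.mem_singleton_self o))).symm

/-- The endpoints of an edge have images within distance `R`, so the increment is bounded by the
function `e` of `exists_bound_of_walk_length_le` at `φ x`. Bounded degree and bounded fibres limit
how often each value of `e` is used. -/
lemma IsTame.exists_energy_comp_le (hH : H.Connected) (hp : 1 ≤ p) {k l : ℕ}
    (hk : ∀ x, G.degree x ≤ k) (hl : ∀ y, H.degree y ≤ l) {φ : V → W} (hφ : IsTame G H φ) :
    ∃ C : ℝ≥0∞, C ≠ ⊤ ∧ ∀ f : W → ℝ, energy G p (f ∘ φ) ≤ C * energy H p f := by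
  obtain ⟨hfib, R, hR⟩ := hφ
  obtain ⟨C, hC, hCf⟩ := exists_bound_of_walk_length_le hp hl R
  obtain ⟨N, hN⟩ := hfib.exists_tsum_comp_le
  refine ⟨k * (N * C), ENNReal.mul_ne_top (by simp) (ENNReal.mul_ne_top (by simp) hC),
    fun f => ?_⟩
  obtain ⟨e, he, hef⟩ := hCf f
  have h1 : ∀ x, ENNReal.ofReal (gradPow G p (f ∘ φ) x) ≤ k * e (φ x) := by
    intro x
    unfold gradPow
    rw [ENNReal.ofReal_sum_of_nonneg fun _ _ => Real.rpow_nonneg (abs_nonneg _) _]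
    calc ∑ y ∈ G.neighborFinset x, ENNReal.ofReal (|(f ∘ φ) y - (f ∘ φ) x| ^ p)
        ≤ ∑ _y ∈ G.neighborFinset x, e (φ x) := by
          refine Finset.sum_le_sum fun y hy => ?_
          obtain ⟨w, hw⟩ := hH.exists_walk_length_eq_dist (φ x) (φ y)
          exact hef _ _ w (hw.trans_le (hR x y ((G.mem_neighborFinset x y).1 hy)))
      _ ≤ k * e (φ x) := by
          rw [Finset.sum_const, G.card_neighborFinset_eq_degree, nsmul_eq_mul]
          gcongr
          exact hk x
  calc energy G p (f ∘ φ) ≤ ∑' x, k * e (φ x) := ENNReal.tsum_le_tsum h1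
    _ ≤ k * (N * (C * energy H p f)) := by
      rw [ENNReal.tsum_mul_left]
      gcongr
      refine (hN e).trans ?_
      gcongr
    _ = _ := by ring

lemma IsTame.comp_mem_BD (hH : H.Connected) (hp : 1 < p) {k l : ℕ}
    (hk : ∀ x, G.degree x ≤ k) (hl : ∀ y, H.degree y ≤ l) {φ : V → W} (hφ : IsTame G H φ)
    {f : W → ℝ} (hf : f ∈ BD H p hp) : f ∘ φ ∈ BD G p hp := by
  obtain ⟨C, hC, hCf⟩ := hφ.exists_energy_comp_le hH hp.le hk hl
  obtain ⟨M, hM⟩ := hf.2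
  exact ⟨dirichletFinite_iff_energy_ne_top.2 (ne_top_of_le_ne_top
    (ENNReal.mul_ne_top hC (dirichletFinite_iff_energy_ne_top.1 hf.1)) (hCf f)),
    M, fun x => hM (φ x)⟩

lemma IsTame.comp_mem_BD0 (hH : H.Connected) (hp : 1 < p) {k l : ℕ}
    (hk : ∀ x, G.degree x ≤ k) (hl : ∀ y, H.degree y ≤ l) {φ : V → W} (hφ : IsTame G H φ)
    {oG : V} {oH : W} {f : W → ℝ} (hf : f ∈ BD0 H p hp oH) : f ∘ φ ∈ BD0 G p hp oG := by
  obtain ⟨C, hC, hCf⟩ := hφ.exists_energy_comp_le hH hp.le hk hl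
  obtain ⟨u, hu, hue, hux⟩ := exists_seq_of_mem_BD0 hH hp hf
  refine mem_BD0_of_tendsto hp (hφ.comp_mem_BD hH hp hk hl hf.1) (l := atTop)
    (u := fun n => u n ∘ φ) (fun n => hφ.1.finite_preimage (hu n)) ?_ (hux _)
  have h1 := ENNReal.Tendsto.const_mul (a := C) hue (Or.inr hC)
  rw [mul_zero] at h1
  exact tendsto_of_tendsto_of_tendsto_of_le_of_le tendsto_const_nhds h1 (fun _ => zero_le)
    fun n => hCf (f - u n)

/-- Composing with two maps at bounded distance gives the same function modulo `BD0`. -/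
lemma comp_sub_comp_mem_BD0 (hH : H.Connected) (hp : 1 < p) {k l : ℕ}
    (hk : ∀ x, G.degree x ≤ k) (hl : ∀ y, H.degree y ≤ l) {θ η : V → W}
    (hθ : HasBoundedFibers θ) {R : ℕ} (hR : ∀ x, H.dist (θ x) (η x) ≤ R) {o : V}
    {f : W → ℝ} (hf : f ∈ BD H p hp) : f ∘ η - f ∘ θ ∈ BD0 G p hp o := by
  obtain ⟨C, hC, hCf⟩ := exists_bound_of_walk_length_le hp.le hl R
  obtain ⟨N, hN⟩ := hθ.exists_tsum_comp_le
  obtain ⟨e, he, hef⟩ := hCf f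
  obtain ⟨M, hM⟩ := hf.2
  refine mem_BD0_of_tsum_ne_top hp hk ⟨M + M, fun x => ?_⟩ ?_
  · exact (abs_sub _ _).trans (add_le_add (hM _) (hM _))
  · refine ne_top_of_le_ne_top (ENNReal.mul_ne_top (by simp)
      (ne_top_of_le_ne_top (ENNReal.mul_ne_top hC
        (dirichletFinite_iff_energy_ne_top.1 hf.1)) he)) (le_trans ?_ (hN e))
    refine ENNReal.tsum_le_tsum fun x => ?_
    obtain ⟨w, hw⟩ := hH.exists_walk_length_eq_dist (θ x) (η x)
    exact hef _ _ w (hw.trans_le (hR x))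

end

/-! ### Maps of spectra, the boundary homeomorphism and the bijection of `BHD`. -/

section

variable {V W : Type*} {G : SimpleGraph V} {H : SimpleGraph W} [G.LocallyFinite] {p : ℝ}
  {hp : 1 < p}

lemma comp_sub_self_mem_BD0 (hG : G.Connected) {k : ℕ} (hk : ∀ x, G.degree x ≤ k) {θ : V → V}
    {r : ℝ} (hθ : ∀ x, (G.dist (θ x) x : ℝ) ≤ r) (o : V) {f : V → ℝ} (hf : f ∈ BD G p hp) :
    f ∘ θ - f ∈ BD0 G p hp o := by
  -- The identity serves as the map with bounded fibres, so nothing is required of the fibres of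
  -- `θ`.
  refine comp_sub_comp_mem_BD0 hG hp hk hk hasBoundedFibers_id (R := ⌈r⌉₊) (fun x => ?_) hf
  have h1 := (hθ x).trans (Nat.le_ceil _)
  rw [SimpleGraph.dist_comm] at h1
  exact_mod_cast h1

variable [H.LocallyFinite]

/-- Composition with `φ`, as an algebra homomorphism. -/
def pullback (φ : V → W) (hφ : ∀ f ∈ BD H p hp, f ∘ φ ∈ BD G p hp) :
    BD H p hp →ₐ[ℝ] BD G p hp where
  toFun f := ⟨f.1 ∘ φ, hφ f.1 f.2⟩
  map_one' := rfl
  map_mul' _ _ := rfl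
  map_zero' := rfl
  map_add' _ _ := rfl
  commutes' _ := rfl

/-- The map of spectra induced by `φ`. -/
noncomputable def spectrumMap (φ : V → W) (hφ : ∀ f ∈ BD H p hp, f ∘ φ ∈ BD G p hp)
    (τ : Sp G p hp) : Sp H p hp :=
  AlgHom.comp (show BD G p hp →ₐ[ℝ] ℂ from τ) (pullback φ hφ)

lemma continuous_gelfand (f : BD G p hp) : Continuous (gelfand f) :=
  (continuous_apply f).comp continuous_induced_dom

lemma continuous_spectrumMap (φ : V → W) (hφ : ∀ f ∈ BD H p hp, f ∘ φ ∈ BD G p hp) :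
    Continuous (spectrumMap φ hφ) :=
  continuous_induced_rng.2 (continuous_pi fun _ => continuous_gelfand _)

lemma gelfand_sub (f g : BD G p hp) (τ : Sp G p hp) :
    gelfand (f - g) τ = gelfand f τ - gelfand g τ :=
  map_sub (show BD G p hp →ₐ[ℝ] ℂ from τ) f g

/-- A character that vanishes on `BD0` is not a point evaluation. -/
lemma mem_harmonicBoundary_of_forall {o : V} {τ : Sp G p hp}
    (h : ∀ f : BD G p hp, (f : V → ℝ) ∈ BD0 G p hp o → gelfand f τ = 0) :
    τ ∈ harmonicBoundary G p hp o := by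
  classical
  refine ⟨?_, h⟩
  rintro ⟨x, rfl⟩
  have hfin : (Function.support (Pi.single x 1 : V → ℝ)).Finite :=
    (Set.finite_singleton x).subset Pi.support_single_subset
  have h1 := h ⟨_, mem_BD_of_finite_support hp hfin⟩ (mem_BD0_of_finite_support hp hfin)
  have h2 : gelfand ⟨Pi.single x 1, mem_BD_of_finite_support hp hfin⟩ (vertexChar G p hp x) =
      (((Pi.single x 1 : V → ℝ) x : ℝ) : ℂ) := rfl
  rw [h2, Pi.single_eq_same] at h1
  norm_num at h1

/-- Functions that agree modulo `BD0` have the same values on the harmonic boundary. -/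
lemma gelfand_eq_of_sub_mem_BD0 {o : V} {τ : Sp G p hp} (hτ : τ ∈ harmonicBoundary G p hp o)
    {f g : BD G p hp} (hfg : (f : V → ℝ) - g ∈ BD0 G p hp o) : gelfand f τ = gelfand g τ := by
  rw [← sub_eq_zero, ← gelfand_sub]
  exact hτ.2 (f - g) hfg

lemma spectrumMap_mem_harmonicBoundary {φ : V → W} (hφ : ∀ f ∈ BD H p hp, f ∘ φ ∈ BD G p hp)
    {oG : V} {oH : W} (hφ0 : ∀ f ∈ BD0 H p hp oH, f ∘ φ ∈ BD0 G p hp oG) {τ : Sp G p hp}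
    (hτ : τ ∈ harmonicBoundary G p hp oG) :
    spectrumMap φ hφ τ ∈ harmonicBoundary H p hp oH :=
  mem_harmonicBoundary_of_forall fun f hf => hτ.2 _ (hφ0 f.1 hf)

lemma spectrumMap_spectrumMap_eq {φ : V → W} {ψ : W → V}
    (hφ : ∀ f ∈ BD H p hp, f ∘ φ ∈ BD G p hp) (hψ : ∀ f ∈ BD G p hp, f ∘ ψ ∈ BD H p hp) {o : V}
    (hψφ : ∀ f ∈ BD G p hp, (f ∘ ψ) ∘ φ - f ∈ BD0 G p hp o) {τ : Sp G p hp}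
    (hτ : τ ∈ harmonicBoundary G p hp o) : spectrumMap ψ hψ (spectrumMap φ hφ τ) = τ :=
  AlgHom.ext fun f => gelfand_eq_of_sub_mem_BD0 (f := ⟨(f.1 ∘ ψ) ∘ φ, _⟩) hτ (hψφ f.1 f.2)

/-- Maps inducing mutually inverse maps modulo `BD0` induce a homeomorphism of the harmonic
boundaries. -/
noncomputable def harmonicBoundaryHomeomorph {φ : V → W} {ψ : W → V} {oG : V} {oH : W}
    (hφ : ∀ f ∈ BD H p hp, f ∘ φ ∈ BD G p hp) (hψ : ∀ f ∈ BD G p hp, f ∘ ψ ∈ BD H p hp)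
    (hφ0 : ∀ f ∈ BD0 H p hp oH, f ∘ φ ∈ BD0 G p hp oG)
    (hψ0 : ∀ f ∈ BD0 G p hp oG, f ∘ ψ ∈ BD0 H p hp oH)
    (hψφ : ∀ f ∈ BD G p hp, (f ∘ ψ) ∘ φ - f ∈ BD0 G p hp oG)
    (hφψ : ∀ f ∈ BD H p hp, (f ∘ φ) ∘ ψ - f ∈ BD0 H p hp oH) :
    harmonicBoundary G p hp oG ≃ₜ harmonicBoundary H p hp oH where
  toFun τ := ⟨spectrumMap φ hφ τ, spectrumMap_mem_harmonicBoundary hφ hφ0 τ.2⟩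
  invFun τ := ⟨spectrumMap ψ hψ τ, spectrumMap_mem_harmonicBoundary hψ hψ0 τ.2⟩
  left_inv τ := Subtype.ext (spectrumMap_spectrumMap_eq hφ hψ hψφ τ.2)
  right_inv τ := Subtype.ext (spectrumMap_spectrumMap_eq hψ hφ hφψ τ.2)
  continuous_toFun :=
    ((continuous_spectrumMap φ hφ).comp continuous_subtype_val).subtype_mk _
  continuous_invFun :=
    ((continuous_spectrumMap ψ hψ).comp continuous_subtype_val).subtype_mk _

/-- If `g` is a harmonic projection of `h ∘ ψ`, then `h` is one of `g ∘ φ`. -/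
lemma IsHarmonicProjection.comp_symm (hG : G.Connected) {φ : V → W} {ψ : W → V} {oG : V}
    {oH : W} (hφ : ∀ f ∈ BD H p hp, f ∘ φ ∈ BD G p hp)
    (hφ0 : ∀ f ∈ BD0 H p hp oH, f ∘ φ ∈ BD0 G p hp oG)
    (hψφ : ∀ f ∈ BD G p hp, (f ∘ ψ) ∘ φ - f ∈ BD0 G p hp oG) {h : V → ℝ} {g : W → ℝ}
    (hh : h ∈ BHD G p hp) (hg : IsHarmonicProjection H p hp oH (h ∘ ψ) g) :
    IsHarmonicProjection G p hp oG (g ∘ φ) h := by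
  refine ⟨hφ g hg.2.1.2, hh, ?_⟩
  -- `g ∘ φ - h` is `((h ∘ ψ) ∘ φ - h) - (h ∘ ψ - g) ∘ φ`.
  have h1 := sub_mem_BD0 hG hp (hψφ h hh.2) (hφ0 _ hg.2.2)
  convert h1 using 1
  funext x
  simp

/-- The bijection between the bounded `p`-harmonic Dirichlet finite functions. -/
lemma exists_BHD_equiv [Countable V] [Countable W] (hG : G.Connected) (hH : H.Connected)
    {φ : V → W} {ψ : W → V} {oG : V} {oH : W}
    (hφ : ∀ f ∈ BD H p hp, f ∘ φ ∈ BD G p hp) (hψ : ∀ f ∈ BD G p hp, f ∘ ψ ∈ BD H p hp)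
    (hφ0 : ∀ f ∈ BD0 H p hp oH, f ∘ φ ∈ BD0 G p hp oG)
    (hψ0 : ∀ f ∈ BD0 G p hp oG, f ∘ ψ ∈ BD0 H p hp oH)
    (hψφ : ∀ f ∈ BD G p hp, (f ∘ ψ) ∘ φ - f ∈ BD0 G p hp oG)
    (hφψ : ∀ f ∈ BD H p hp, (f ∘ φ) ∘ ψ - f ∈ BD0 H p hp oH) :
    ∃ Φ : BHD G p hp ≃ BHD H p hp,
      ∀ h, IsHarmonicProjection H p hp oH (h.1 ∘ ψ) (Φ h).1 := by
  by_cases h1 : (fun _ => 1) ∈ BD0 H p hp oH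
  · have h1' : (fun _ => 1) ∈ BD0 G p hp oG := by
      simpa only [Function.comp_def] using hφ0 _ h1
    -- Here `BHD` consists of constants on both sides, and constants are matched by value. Every
    -- element of `BHD` is a harmonic projection of everything, so this choice is as good as any.
    refine ⟨⟨fun h => ⟨_, const_mem_BHD hp (h.1 oG)⟩,
      fun h => ⟨_, const_mem_BHD hp (h.1 oH)⟩, fun h => ?_, fun h => ?_⟩, fun h => ?_⟩
    · exact Subtype.ext (funext fun x => BHD.eq_of_one_mem hG hp h1' h.2 oG x)
    · exact Subtype.ext (funext fun x => BHD.eq_of_one_mem hH hp h1 h.2 oH x)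
    · have h2 := hψ _ h.2.2
      exact ⟨h2, const_mem_BHD hp (h.1 oG),
        mem_BD0_of_one_mem hH hp h1 ((BD H p hp).sub_mem h2 (const_mem_BHD hp (h.1 oG)).2)⟩
  · have h1' : (fun _ => 1) ∉ BD0 G p hp oG := fun h => h1 (by
      simpa only [Function.comp_def] using hψ0 _ h)
    choose P hP using fun h : BHD G p hp =>
      exists_isHarmonicProjection hp oH (hψ h.1 h.2.2)
    choose Q hQ using fun h : BHD H p hp =>
      exists_isHarmonicProjection hp oG (hφ h.1 h.2.2)
    refine ⟨⟨fun h => ⟨P h, (hP h).2.1⟩, fun g => ⟨Q g, (hQ g).2.1⟩, fun h => ?_, fun g => ?_⟩,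
      hP⟩
    -- Both `Q (P h)` and `h` are harmonic projections of `P h ∘ φ`, hence equal.
    · exact Subtype.ext (IsHarmonicProjection.unique hG hp h1' (hQ ⟨P h, (hP h).2.1⟩)
        (IsHarmonicProjection.comp_symm hG hφ hφ0 hψφ h.2 (hP h)))
    · exact Subtype.ext (IsHarmonicProjection.unique hH hp h1 (hP ⟨Q g, (hQ g).2.1⟩)
        (IsHarmonicProjection.comp_symm hH hψ hψ0 hφψ g.2 (hQ g)))

/-- Harmonic projections of `h ∘ ψ` do not depend on the rough inverse `ψ`. -/
lemma IsHarmonicProjection.congr_comp (hH : H.Connected) {φ : V → W} {ψ ψ' : W → V} {oG : V}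
    {oH : W} (hψ : ∀ f ∈ BD G p hp, f ∘ ψ ∈ BD H p hp)
    (hψ' : ∀ f ∈ BD G p hp, f ∘ ψ' ∈ BD H p hp)
    (hψ0' : ∀ f ∈ BD0 G p hp oG, f ∘ ψ' ∈ BD0 H p hp oH)
    (hψφ : ∀ f ∈ BD G p hp, (f ∘ ψ) ∘ φ - f ∈ BD0 G p hp oG)
    (hφψ' : ∀ f ∈ BD H p hp, (f ∘ φ) ∘ ψ' - f ∈ BD0 H p hp oH) {h : V → ℝ} {g : W → ℝ}
    (hh : h ∈ BD G p hp) (hg : IsHarmonicProjection H p hp oH (h ∘ ψ) g) :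
    IsHarmonicProjection H p hp oH (h ∘ ψ') g := by
  refine ⟨hψ' h hh, hg.2.1, ?_⟩
  -- `h ∘ ψ` and `h ∘ ψ'` are compared through `h ∘ ψ ∘ φ ∘ ψ'`, which agrees with each of them
  -- modulo `BD0`.
  have h1 := add_mem_BD0 hH hp hg.2.2
    (sub_mem_BD0 hH hp (hφψ' _ (hψ h hh)) (hψ0' _ (hψφ h hh)))
  convert h1 using 1
  funext y
  simp

end

end PHarm

/-! ### Assembly. -/

theorem theorem2p7 {V W : Type*} [Countable V] [Infinite V] [Countable W] [Infinite W]
    (G : SimpleGraph V) (H : SimpleGraph W) [G.LocallyFinite] [H.LocallyFinite]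
    (hG : G.Connected) (hH : H.Connected)
    (hGdeg : ∃ k : ℕ, ∀ x, G.degree x ≤ k) (hHdeg : ∃ k : ℕ, ∀ y, H.degree y ≤ k)
    (oG : V) (oH : W) (p : ℝ) (hp : 1 < p)
    (φ : V → W) (hφ : IsRoughIsometry G H φ) :
    ∃ (φbar : harmonicBoundary G p hp oG ≃ₜ harmonicBoundary H p hp oH)
      (Φ : BHD G p hp ≃ BHD H p hp),
      -- the homeomorphism is the continuous extension of `φ` to the boundary
      (∀ x : harmonicBoundary G p hp oG,
        Tendsto (fun v => vertexChar H p hp (φ v))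
          (comap (vertexChar G p hp) (𝓝 (x : Sp G p hp))) (𝓝 (φbar x : Sp H p hp))) ∧
      -- the bijection transports boundary values by the homeomorphism
      (∀ (h : BHD G p hp) (x : harmonicBoundary G p hp oG),
        gelfand (BHD.toBD (Φ h)) (φbar x : Sp H p hp) = gelfand (BHD.toBD h) (x : Sp G p hp)) ∧
      -- the bijection is composition with a rough inverse, followed by harmonic projection
      (∃ ψ : W → V, IsRoughInverse G H φ ψ) ∧
      (∀ ψ : W → V, IsRoughInverse G H φ ψ → ∀ h : BHD G p hp,
        IsHarmonicProjection H p hp oH (h.1 ∘ ψ) (Φ h).1 ∧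
        ((fun _ => 1) ∉ BD0 H p hp oH →
          ∀ g : W → ℝ, IsHarmonicProjection H p hp oH (h.1 ∘ ψ) g → g = (Φ h).1)) := by
  obtain ⟨k, hk⟩ := hGdeg
  obtain ⟨l, hl⟩ := hHdeg
  obtain ⟨ψ, hψ⟩ := hφ.exists_isRoughInverse hH
  have hφt := hφ.isTame hG hk
  have hψt : ∀ ψ, IsRoughInverse G H φ ψ → IsTame H G ψ := fun _ h => h.1.isTame hH hl
  have hφ1 : ∀ f ∈ BD H p hp, f ∘ φ ∈ BD G p hp := fun _ => hφt.comp_mem_BD hH hp hk hl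
  have hφ0 : ∀ f ∈ BD0 H p hp oH, f ∘ φ ∈ BD0 G p hp oG := fun _ =>
    hφt.comp_mem_BD0 hH hp hk hl
  have hψ1 : ∀ ψ, IsRoughInverse G H φ ψ → ∀ f ∈ BD G p hp, f ∘ ψ ∈ BD H p hp := fun ψ h _ =>
    (hψt ψ h).comp_mem_BD hG hp hl hk
  have hψ0 : ∀ ψ, IsRoughInverse G H φ ψ → ∀ f ∈ BD0 G p hp oG, f ∘ ψ ∈ BD0 H p hp oH :=
    fun ψ h _ => (hψt ψ h).comp_mem_BD0 hG hp hl hk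
  have hψφ : ∀ f ∈ BD G p hp, (f ∘ ψ) ∘ φ - f ∈ BD0 G p hp oG := by
    obtain ⟨-, a, b, c, -, h, -⟩ := hψ
    exact fun _ => comp_sub_self_mem_BD0 hG hk (θ := ψ ∘ φ) h oG
  have hφψ : ∀ ψ, IsRoughInverse G H φ ψ → ∀ f ∈ BD H p hp, (f ∘ φ) ∘ ψ - f ∈ BD0 H p hp oH := by
    rintro ψ ⟨-, a, b, c, -, -, h⟩
    exact fun _ => comp_sub_self_mem_BD0 hH hl (θ := φ ∘ ψ) h oH
  obtain ⟨Φ, hΦ⟩ := exists_BHD_equiv hG hH hφ1 (hψ1 ψ hψ) hφ0 (hψ0 ψ hψ) hψφ (hφψ ψ hψ)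
  have hΦ' : ∀ ψ, IsRoughInverse G H φ ψ → ∀ h : BHD G p hp,
      IsHarmonicProjection H p hp oH (h.1 ∘ ψ) (Φ h).1 := fun ψ' h' h =>
    IsHarmonicProjection.congr_comp hH (hψ1 ψ hψ) (hψ1 ψ' h') (hψ0 ψ' h') hψφ (hφψ ψ' h')
      h.2.2 (hΦ h)
  refine ⟨harmonicBoundaryHomeomorph hφ1 (hψ1 ψ hψ) hφ0 (hψ0 ψ hψ) hψφ (hφψ ψ hψ), Φ,
    fun x => ?_, fun h x => ?_, ⟨ψ, hψ⟩, fun ψ' h' h => ⟨hΦ' ψ' h' h, fun h1 g hg =>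
      hg.unique hH hp h1 (hΦ' ψ' h' h)⟩⟩
  -- By definition the map of spectra sends evaluation at `v` to evaluation at `φ v`, so continuity
  -- at the boundary point is the claim.
  · exact ((continuous_spectrumMap φ hφ1).tendsto (x : Sp G p hp)).comp tendsto_comap
  -- The left side is by definition the value of `Φ h ∘ φ` at `x`, and `Φ h ∘ φ` differs from `h` by
  -- an element of `BD0`.
  · exact gelfand_eq_of_sub_mem_BD0 (f := ⟨(Φ h).1 ∘ φ, hφ1 _ (Φ h).2.2⟩) x.2
      (IsHarmonicProjection.comp_symm hG hφ1 hφ0 hψφ h.2 (hΦ h)).2.2
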